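/- A reflection of a finite-dimensional vector space is a linear endomorphism of order $2$ that fixes some hyperplane pointwise; for a free module $M$ of finite rank over a subring $T\subset\mathbf C$ with fraction field $K$, a reflection of $M$ is an endomorphism of $M$ that becomes a reflection of $M\otimes_T K$. Let $\mathbf F$ be a finite field of characteristic $p\neq 2$. A Coxeter arrangement over $\mathbf F$ is a triple $(V,G,q)$, where $V$ is a finite-dimensional $\mathbf F$-vector space, $G$ is a finite subgroup of $\mathrm{GL}(V)$ generated by reflections, and $q$ is a $G$-invariant nondegenerate symmetric bilinear form on $V$. A classical Coxeter arrangement is such a triple over $\mathbf R$ with $q$ positive definite. A Coxeter arrangement over $\mathbf C$ is such a triple over $\mathbf C$ that arises, up to isomorphism, by extension of scalars from a classical Coxeter arrangement. For a subring $T\subset\mathbf C$, a Coxeter arrangement over $T$ is a triple $(M,G,q)$, where $M$ is a free $T$-module of finite rank, $G$ is a finite subgroup of $\mathrm{GL}(M)$ generated by reflections, and $q$ is a $G$-invariant nondegenerate symmetric bilinear form on $M$, such that the triple obtained by extension of scalars to $\mathbf C$ is a Coxeter arrangement over $\mathbf C$. **Proposition 1.6.** Let $(V,G,q)$ be a Coxeter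 arrangement over $\mathbf F$ such that $p$ does not divide $|G|$. Then $(V,G,q)$ is liftable: there exist a discrete valuation ring $T\subset\mathbf C$ with residue field (isomorphic to) $\mathbf F$ and with fraction field of finite degree over $\mathbf Q$, a Coxeter arrangement $(M_T,G_T,q_T)$ over $T$, and an isomorphism $M_T\otimes_T\mathbf F\cong V$ of $\mathbf F$-vector spaces that identifies the image $\overline{G}_T$ of $G_T$ in $\mathrm{GL}(M_T\otimes_T\mathbf F)$ with $G$ and the form $\overline{q}_T$ induced by $q_T$ with $q$. -/

import Mathlib

open scoped TensorProduct

noncomputable section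

namespace CoxeterArr

/-- The data `(G, q)` carried by a module `M` in a triple `(M, G, q)`: a subgroup `G` of `GL(M)`
and a bilinear form `q` on `M`. No condition is imposed at this point. -/
structure Triple (R M : Type*) [CommRing R] [AddCommGroup M] [Module R M] where
  /-- the group `G` -/
  group : Subgroup (LinearMap.GeneralLinearGroup R M)
  /-- the bilinear form `q` -/
  form : LinearMap.BilinForm R M

/-- A reflection: an endomorphism of order `2` which fixes pointwise some hyperplane.
A hyperplane is the kernel of a nonzero linear form. Over a domain `R` with fraction field `K` and
a free module `M` of finite rank, a hyperplane of `M ⊗ K` is likewise the kernel of a nonzero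
linear form that (after clearing denominators) has values in `R` on `M`. -/
def IsReflection {R M : Type*} [CommRing R] [AddCommGroup M] [Module R M]
    (s : Module.End R M) : Prop :=
  orderOf s = 2 ∧ ∃ l : M →ₗ[R] R, l ≠ 0 ∧ ∀ x, l x = 0 → s x = x

namespace Triple

/-- Extension of scalars of `(M, G, q)` along `R → S`: the module is `S ⊗ M`, the group is the
image of `G` in `GL(S ⊗ M)` and the form is the one induced by `q`. When `S` is a residue field of
`R`, this is the reduction `(M̄, Ḡ, q̄)`. -/
def baseChange {R M : Type*} [CommRing R] [AddCommGroup M] [Module R M]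
    (S : Type*) [CommRing S] [Algebra R S] (A : Triple R M) : Triple S (S ⊗[R] M) where
  group := A.group.map
    (Units.map (Module.End.baseChangeHom R S M : Module.End R M →* Module.End S (S ⊗[R] M)))
  form := LinearMap.BilinForm.baseChange S A.form

/-- Two triples over `R` are isomorphic: some linear isomorphism of the modules identifies
the groups (by conjugation) and the forms. -/
def IsIsomorphic {R M N : Type*} [CommRing R] [AddCommGroup M] [Module R M]
    [AddCommGroup N] [Module R N] (A : Triple R M) (B : Triple R N) : Prop :=
  ∃ e : M ≃ₗ[R] N,
    A.group.map (LinearMap.GeneralLinearGroup.congrLinearEquiv e :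
      LinearMap.GeneralLinearGroup R M →* LinearMap.GeneralLinearGroup R N) = B.group ∧
    ∀ x y, B.form (e x) (e y) = A.form x y

/-- The conditions common to all kinds of Coxeter arrangements: `M` is free of finite rank,
`G` is a finite group generated by reflections, and `q` is a `G`-invariant nondegenerate symmetric
bilinear form. -/
structure IsReflectionTriple {R M : Type*} [CommRing R] [AddCommGroup M] [Module R M]
    (A : Triple R M) : Prop where
  free : Module.Free R M
  finite_rank : Module.Finite R M
  finite_group : Finite A.group
  generated : Subgroup.closure
    {g | g ∈ A.group ∧ IsReflection (g : Module.End R M)} = A.group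
  invariant : ∀ g ∈ A.group, ∀ x y,
    A.form ((g : Module.End R M) x) ((g : Module.End R M) y) = A.form x y
  symm : A.form.IsSymm
  nondegenerate : A.form.Nondegenerate

/-- A Coxeter arrangement over a field such as a finite field: no condition besides the common
ones. -/
def IsCoxeterOverField {F V : Type*} [Field F] [AddCommGroup V] [Module F V]
    (A : Triple F V) : Prop :=
  A.IsReflectionTriple

/-- A classical Coxeter arrangement: over the real numbers, with a positive definite form. -/
structure IsClassicalCoxeter {V : Type*} [AddCommGroup V] [Module ℝ V]
    (A : Triple ℝ V) : Prop where
  isReflectionTriple : A.IsReflectionTriple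
  posDef : ∀ x, x ≠ 0 → 0 < A.form x x

/-- A Coxeter arrangement over `ℂ`: it arises by extension of scalars from a classical
Coxeter arrangement. (The real vector space may be taken in the lowest universe, since it is
finite-dimensional.) -/
structure IsComplexCoxeter {V : Type*} [AddCommGroup V] [Module ℂ V]
    (A : Triple ℂ V) : Prop where
  isReflectionTriple : A.IsReflectionTriple
  exists_real_form : ∃ (W : Type) (_ : AddCommGroup W) (_ : Module ℝ W) (B : Triple ℝ W),
    B.IsClassicalCoxeter ∧ (B.baseChange ℂ).IsIsomorphic A

/-- A Coxeter arrangement over a subring `T` of `ℂ`: it induces by extension of scalars a Coxeter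
arrangement over `ℂ`. -/
structure IsCoxeterOverSubring (T : Subring ℂ) {M : Type*} [AddCommGroup M] [Module T M]
    (A : Triple T M) : Prop where
  isReflectionTriple : A.IsReflectionTriple
  complex : (A.baseChange ℂ).IsComplexCoxeter

/-- A triple over a field `F` is liftable: there are a discrete valuation ring `T ⊆ ℂ` with
fraction field of finite degree over `ℚ` and residue field `F` (that is, with a surjective ring
homomorphism `T → F`, whose kernel is then the maximal ideal) and a Coxeter arrangement over `T`
whose reduction is isomorphic to the given triple. -/
def IsLiftable {F V : Type*} [Field F] [AddCommGroup V] [Module F V] (A : Triple F V) : Prop :=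
  ∃ (T : Subring ℂ) (_ : IsDiscreteValuationRing T) (_ : Algebra T F)
    (M : Type) (_ : AddCommGroup M) (_ : Module T M) (B : Triple T M),
    NumberField (FractionRing T) ∧
    Function.Surjective (algebraMap T F) ∧
    B.IsCoxeterOverSubring T ∧
    (B.baseChange F).IsIsomorphic A

end Triple

end CoxeterArr

end

open scoped TensorProduct

noncomputable section

namespace CoxeterArr

/-! ### Extension of scalars for reflections and reflection triples. -/

section BaseChange

variable {R M : Type*} [CommRing R] [AddCommGroup M] [Module R M]
  {K : Type*} [Field K] [Algebra R K]

/-! Since $|G|$ is invertible in $\mathbf F$, averaging exhibits $V$ as a direct summand of a sum of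
copies of the regular representation, cut out by an idempotent matrix $e$ commuting with permutation
matrices. Newton iteration from the entrywise Teichmüller lift $E_0$ of $e$ gives an idempotent $E$
over the Witt vectors $W(\mathbf F)$ that commutes with everything commuting with $E_0$
(`exists_idempotent_of_approx`).

The field $K$ generated over $\mathbf Q$ by the entries of $E$ and the Teichmüller representatives
is a number field because its derivations vanish: $D$ kills roots of unity, so $D(E)$ commutes with
$E_0$, hence with $E$, and this forces $D(E)=0$. Then $K\cap W(\mathbf F)$, embedded in $\mathbf C$,
is the ring $T$ (`exists_dvr_lift_idempotent`), and the image of $E$ carries the lifted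
representation (`exists_lift_representation`). The form lifts by averaging, and reflections stay
reflections because $(1-s)/2$ is an idempotent whose reduction has rank one.

The condition over $\mathbf C$ is automatic (`Triple.IsReflectionTriple.isComplexCoxeter`):
comparing $\operatorname{Re} q$ with an invariant Hermitian form gives a commuting antilinear
operator whose positive eigenspaces span a $G$-stable real form on which $q$ is positive definite.
-/

theorem one_tmul_injective [Module.Free R M] (hinj : Function.Injective (algebraMap R K)) :
    Function.Injective (fun x : M => (1 : K) ⊗ₜ[R] x) := by
  have h := Module.Flat.rTensor_preserves_injective_linearMap (M := M) (Algebra.linearMap R K) hinj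
  have h' := h.comp (TensorProduct.lid R M).symm.injective
  convert h' using 1
  ext x
  simp

theorem baseChangeHom_tmul (s : Module.End R M) (c : K) (x : M) :
    Module.End.baseChangeHom R K M s (c ⊗ₜ x) = c ⊗ₜ s x := rfl

theorem baseChange_injective [Module.Free R M] (hinj : Function.Injective (algebraMap R K)) :
    Function.Injective (Module.End.baseChangeHom R K M) := by
  intro s t h
  ext x
  apply one_tmul_injective (K := K) hinj
  exact congrArg (fun u : Module.End K (K ⊗[R] M) => u (1 ⊗ₜ x)) h

/-- A reflection over a domain moves every vector along a fixed line, up to denominators. -/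
theorem IsReflection.exists_smul_sub {s : Module.End R M} (hs : IsReflection s) :
    ∃ (l : M →ₗ[R] R) (a x₀ : M), l x₀ ≠ 0 ∧ ∀ x, l x₀ • (x - s x) = l x • a := by
  obtain ⟨-, l, hl, h⟩ := hs
  obtain ⟨x₀, hx₀⟩ : ∃ x, l x ≠ 0 := by
    by_contra! H
    exact hl (LinearMap.ext H)
  refine ⟨l, x₀ - s x₀, x₀, hx₀, fun x => ?_⟩
  -- Projecting $x$ to the hyperplane along $x_0$, with the denominator $l(x_0)$ cleared.
  have := h (l x₀ • x - l x • x₀) (by simp [mul_comm])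
  simp only [map_sub, map_smul] at this
  rw [smul_sub, smul_sub, sub_eq_sub_iff_add_eq_add]
  rw [sub_eq_sub_iff_add_eq_add] at this
  rw [add_comm, add_comm (l x • x₀), this, add_comm]

/-- The identity of `IsReflection.exists_smul_sub` is linear in $x$, so it extends from pure tensors
to $K\otimes M$, where $l(x_0)$ can be cancelled. This avoids describing the kernel of the extended
linear form. -/
theorem IsReflection.baseChange [Module.Free R M] (hinj : Function.Injective (algebraMap R K))
    {s : Module.End R M} (hs : IsReflection s) :
    IsReflection (Module.End.baseChangeHom R K M s) := by
  refine ⟨?_, ?_⟩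
  · rw [← hs.1]
    exact orderOf_injective
      (Module.End.baseChangeHom R K M : Module.End R M →* Module.End K (K ⊗[R] M))
      (baseChange_injective hinj) s
  · obtain ⟨l, a, x₀, hx₀, h⟩ := hs.exists_smul_sub
    let lK : K ⊗[R] M →ₗ[K] K :=
      (TensorProduct.AlgebraTensorModule.rid R K K).toLinearMap ∘ₗ l.baseChange K
    have hlK : ∀ c x, lK (c ⊗ₜ x) = c * algebraMap R K (l x) := by
      intro c x
      simp [lK, Algebra.smul_def, mul_comm]
    have hne : algebraMap R K (l x₀) ≠ 0 := by
      simpa using (map_ne_zero_iff _ hinj).2 hx₀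
    refine ⟨lK, fun h0 => hne ?_, fun z hz => ?_⟩
    · simpa [h0] using (hlK 1 x₀).symm
    · have key : ∀ z : K ⊗[R] M, algebraMap R K (l x₀) • (z - Module.End.baseChangeHom R K M s z)
          = lK z • (1 : K) ⊗ₜ[R] a := by
        intro z
        induction z with
        | zero => simp
        | add x y hx hy =>
          simp only [map_add, add_smul, ← hx, ← hy, ← smul_add]
          congr 1
          abel
        | tmul c x =>
          rw [baseChangeHom_tmul, hlK, ← TensorProduct.tmul_sub, TensorProduct.smul_tmul',
            TensorProduct.smul_tmul', smul_eq_mul, smul_eq_mul, mul_one, mul_comm c,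
            ← Algebra.smul_def, ← Algebra.smul_def, TensorProduct.smul_tmul, h,
            TensorProduct.smul_tmul]
      have := key z
      rw [hz, zero_smul, smul_eq_zero_iff_right hne, sub_eq_zero] at this
      exact this.symm

namespace Triple

theorem IsReflectionTriple.baseChange [IsDomain R] (hinj : Function.Injective (algebraMap R K))
    {A : Triple R M} (hA : A.IsReflectionTriple) : (A.baseChange K).IsReflectionTriple := by
  have := hA.free
  have := hA.finite_rank
  have := hA.finite_group
  refine ⟨inferInstance, inferInstance, ?_, ?_, ?_, ?_, ?_⟩
  · exact Set.Finite.image _ this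
  · apply le_antisymm
    · rw [Subgroup.closure_le]
      exact fun g hg => hg.1
    · conv_lhs => rw [Triple.baseChange, ← hA.generated]
      rw [MonoidHom.map_closure]
      apply Subgroup.closure_mono
      rintro _ ⟨g, ⟨hg, hr⟩, rfl⟩
      exact ⟨⟨g, hg, rfl⟩, hr.baseChange hinj⟩
  · rintro _ ⟨g, hg, rfl⟩ x y
    have hinv := hA.invariant g hg
    have : (A.baseChange K).form.comp (Module.End.baseChangeHom R K M g)
        (Module.End.baseChangeHom R K M g) = (A.baseChange K).form := by
      ext x y
      change (LinearMap.BilinForm.baseChange K A.form)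
        ((1 : K) ⊗ₜ (g : Module.End R M) x) ((1 : K) ⊗ₜ (g : Module.End R M) y) = _
      simp [Triple.baseChange, hinv]
    exact congrArg (fun B : LinearMap.BilinForm K _ => B x y) this
  · exact ⟨fun x y => (LinearMap.BilinForm.IsSymm.baseChange K (B₂ := A.form) ⟨hA.symm.eq⟩).eq x y⟩
  · let b := Module.Free.chooseBasis R M
    have h := (LinearMap.BilinForm.nondegenerate_iff_det_ne_zero b).1 hA.nondegenerate
    rw [LinearMap.BilinForm.nondegenerate_iff_det_ne_zero (b.baseChange K)]
    have : LinearMap.BilinForm.toMatrix (b.baseChange K) (A.baseChange K).form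
        = (LinearMap.BilinForm.toMatrix b A.form).map (algebraMap R K) := by
      ext i j
      simp [Triple.baseChange, LinearMap.BilinForm.toMatrix_apply, Algebra.smul_def]
    rw [this, ← RingHom.mapMatrix_apply, ← RingHom.map_det]
    exact (map_ne_zero_iff _ hinj).2 h

end Triple

end BaseChange

/-- Serves both the real form and the lift. There $\psi$ is defined on the group only, not on all of
$\mathrm{GL}(M)$, so the closure induction carries the membership proof along. -/
theorem closure_reflections_range {R M S N : Type*} [CommRing R] [AddCommGroup M] [Module R M]
    [CommRing S] [AddCommGroup N] [Module S N] {A : Triple R M}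
    (hgen : Subgroup.closure {g | g ∈ A.group ∧ IsReflection (g : Module.End R M)} = A.group)
    (ψ : A.group →* LinearMap.GeneralLinearGroup S N)
    (hψ : ∀ g : A.group, IsReflection ((g : LinearMap.GeneralLinearGroup R M) : Module.End R M) →
      IsReflection (ψ g : Module.End S N)) :
    Subgroup.closure {g | g ∈ ψ.range ∧ IsReflection (g : Module.End S N)} = ψ.range := by
  apply le_antisymm
  · rw [Subgroup.closure_le]
    exact fun g hg => hg.1
  · have key : ∀ g ∈ Subgroup.closure {g | g ∈ A.group ∧ IsReflection (g : Module.End R M)},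
        ∃ h : g ∈ A.group,
          ψ ⟨g, h⟩ ∈ Subgroup.closure {g | g ∈ ψ.range ∧ IsReflection (g : Module.End S N)} := by
      intro g hg
      induction hg using Subgroup.closure_induction with
      | mem x hx => exact ⟨hx.1, Subgroup.subset_closure ⟨⟨_, rfl⟩, hψ ⟨x, hx.1⟩ hx.2⟩⟩
      | one => exact ⟨A.group.one_mem, by
          convert Subgroup.one_mem _
          exact map_one ψ⟩
      | mul x y _ _ hx hy =>
        obtain ⟨hx, hx'⟩ := hx
        obtain ⟨hy, hy'⟩ := hy
        refine ⟨A.group.mul_mem hx hy, ?_⟩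
        have := Subgroup.mul_mem _ hx' hy'
        rwa [← map_mul] at this
      | inv x _ hx =>
        obtain ⟨hx, hx'⟩ := hx
        refine ⟨A.group.inv_mem hx, ?_⟩
        have := Subgroup.inv_mem _ hx'
        rwa [← map_inv] at this
    rintro _ ⟨⟨g, hg⟩, rfl⟩
    exact (key g (hgen.symm ▸ hg)).2

/-! ### Positive definite real forms of complex reflection triples. -/

section RealForm

/-- Two real symmetric bilinear forms, one of them positive definite, can be diagonalized
simultaneously. -/
theorem exists_iSup_eigenspace_eq_top {V : Type*} [AddCommGroup V] [Module ℝ V]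
    [FiniteDimensional ℝ V] (h r : LinearMap.BilinForm ℝ V) (hs : ∀ x y, h x y = h y x)
    (hpos : ∀ x, x ≠ 0 → 0 < h x x) (rs : ∀ x y, r x y = r y x) :
    ∃ S : Module.End ℝ V, (∀ x y, h (S x) y = r x y) ∧ ⨆ μ, Module.End.eigenspace S μ = ⊤ := by
  have hnd : h.Nondegenerate := by
    refine LinearMap.BilinForm.Nondegenerate.ofSeparatingLeft fun x hx => ?_
    by_contra hne
    exact (hpos x hne).ne' (hx x)
  let S : Module.End ℝ V := LinearMap.BilinForm.symmCompOfNondegenerate r h hnd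
  have hS : ∀ x y, h (S x) y = r x y :=
    fun x y => LinearMap.BilinForm.symmCompOfNondegenerate_left_apply r hnd y x
  refine ⟨S, hS, ?_⟩
  let core : InnerProductSpace.Core ℝ V :=
    { inner := fun x y => h x y
      conj_inner_symm := fun x y => by simpa using hs y x
      re_inner_nonneg := fun x => by
        by_cases hx : x = 0
        · simp [hx]
        · simpa using (hpos x hx).le
      add_left := fun x y z => by simp
      smul_left := fun x y c => by simp
      definite := fun x hx => by
        by_contra hne
        exact (hpos x hne).ne' hx }
  let : NormedAddCommGroup V := core.toNormedAddCommGroup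
  let : InnerProductSpace ℝ V := InnerProductSpace.ofCore core.toCore
  have hsym : LinearMap.IsSymmetric S := by
    intro x y
    change h (S x) y = h x (S y)
    rw [hS, hs x, hS, rs]
  have := hsym.orthogonalComplement_iSup_eigenspaces_eq_bot
  rwa [Submodule.orthogonal_eq_bot_iff] at this

variable {V : Type*} [AddCommGroup V] [Module ℂ V]

/-- The real part of a Hermitian form invariant under a finite group. -/
theorem exists_invariant_inner [FiniteDimensional ℂ V]
    (G : Subgroup (LinearMap.GeneralLinearGroup ℂ V)) [Finite G] :
    ∃ h : LinearMap.BilinForm ℝ V, (∀ x y, h x y = h y x) ∧ (∀ x, x ≠ 0 → 0 < h x x) ∧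
      (∀ x y, h (Complex.I • x) (Complex.I • y) = h x y) ∧
      ∀ g ∈ G, ∀ x y, h ((g : Module.End ℂ V) x) ((g : Module.End ℂ V) y) = h x y := by
  have := Fintype.ofFinite G
  let b := Module.finBasis ℂ V
  let f : G → V → Fin (Module.finrank ℂ V) → ℂ :=
    fun g x i => b.repr ((g : LinearMap.GeneralLinearGroup ℂ V) • x) i
  have fadd : ∀ g x y i, f g (x + y) i = f g x i + f g y i := by
    intro g x y i; simp [f]
  have fsmul : ∀ g (c : ℂ) x i, f g (c • x) i = c * f g x i := by
    intro g c x i; simp [f, smul_comm _ c x]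
  have frsmul : ∀ g (c : ℝ) x i, f g (c • x) i = c * f g x i := by
    intro g c x i
    rw [← Complex.coe_smul, fsmul]
  -- The real part of $\sum_g\sum_i (gx)_i\overline{(gy)_i}$ in coordinates for `b`.
  let h : LinearMap.BilinForm ℝ V := LinearMap.mk₂ ℝ
    (fun x y => ∑ g, ∑ i, ((f g x i).re * (f g y i).re + (f g x i).im * (f g y i).im))
    (by intro x y z
        simp only [fadd, ← Finset.sum_add_distrib, Complex.add_re, Complex.add_im]
        exact Finset.sum_congr rfl fun _ _ => Finset.sum_congr rfl fun _ _ => by ring)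
    (by intro c x z
        simp only [frsmul, Finset.smul_sum, Complex.re_ofReal_mul, Complex.im_ofReal_mul]
        exact Finset.sum_congr rfl fun _ _ => Finset.sum_congr rfl fun _ _ => by
          rw [smul_eq_mul]; ring)
    (by intro x y z
        simp only [fadd, ← Finset.sum_add_distrib, Complex.add_re, Complex.add_im]
        exact Finset.sum_congr rfl fun _ _ => Finset.sum_congr rfl fun _ _ => by ring)
    (by intro c x z
        simp only [frsmul, Finset.smul_sum, Complex.re_ofReal_mul, Complex.im_ofReal_mul]
        exact Finset.sum_congr rfl fun _ _ => Finset.sum_congr rfl fun _ _ => by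
          rw [smul_eq_mul]; ring)
  have hh : ∀ x y, h x y =
      ∑ g, ∑ i, ((f g x i).re * (f g y i).re + (f g x i).im * (f g y i).im) := fun _ _ => rfl
  refine ⟨h, fun x y => ?_, fun x hx => ?_, fun x y => ?_, fun g hg x y => ?_⟩
  · simp only [hh]
    exact Finset.sum_congr rfl fun _ _ => Finset.sum_congr rfl fun _ _ => by ring
  · rw [hh]
    have hnn : ∀ g i, 0 ≤ (f g x i).re * (f g x i).re + (f g x i).im * (f g x i).im :=
      fun g i => add_nonneg (mul_self_nonneg _) (mul_self_nonneg _)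
    obtain ⟨i, hi⟩ : ∃ i, b.repr x i ≠ 0 := by
      by_contra! H
      exact hx (b.repr.map_eq_zero_iff.1 (Finsupp.ext H))
    have h1 : f 1 x i = b.repr x i := by simp [f]
    have h2 : 0 < (f 1 x i).re * (f 1 x i).re + (f 1 x i).im * (f 1 x i).im := by
      rw [h1, ← Complex.normSq_apply]
      exact Complex.normSq_pos.2 hi
    refine lt_of_lt_of_le h2 ((Finset.single_le_sum (f := fun i => (f 1 x i).re * (f 1 x i).re
      + (f 1 x i).im * (f 1 x i).im) (fun i _ => hnn 1 i) (Finset.mem_univ i)).trans ?_)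
    exact Finset.single_le_sum (f := fun g => ∑ i, ((f g x i).re * (f g x i).re
      + (f g x i).im * (f g x i).im)) (fun g _ => Finset.sum_nonneg fun i _ => hnn g i)
      (Finset.mem_univ 1)
  · simp only [hh, fsmul]
    refine Finset.sum_congr rfl fun _ _ => Finset.sum_congr rfl fun _ _ => ?_
    simp
    ring
  · simp only [hh]
    have hf : ∀ k x i, f k ((g : Module.End ℂ V) x) i = f (k * ⟨g, hg⟩) x i := by
      intro k x i
      simp only [f, Subgroup.coe_mul, mul_smul]
      rfl
    simp only [hf]
    exact Equiv.sum_comp (Equiv.mulRight (⟨g, hg⟩ : G))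
      fun k => ∑ i, ((f k x i).re * (f k y i).re + (f k x i).im * (f k y i).im)

/-- A complex space with a form invariant under a finite group is the complexification of an invariant
real subspace on which the form is real and positive definite. -/
theorem exists_real_form_of_form [FiniteDimensional ℂ V]
    (G : Subgroup (LinearMap.GeneralLinearGroup ℂ V)) [Finite G] (q : LinearMap.BilinForm ℂ V)
    (qs : ∀ x y, q x y = q y x) (qnd : q.Nondegenerate)
    (hq : ∀ g ∈ G, ∀ x y, q ((g : Module.End ℂ V) x) ((g : Module.End ℂ V) y) = q x y) :
    ∃ W : Submodule ℝ V, (∀ g ∈ G, ∀ x ∈ W, (g : Module.End ℂ V) x ∈ W) ∧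
      (∀ x ∈ W, ∀ y ∈ W, (q x y).im = 0) ∧ (∀ x ∈ W, x ≠ 0 → 0 < (q x x).re) ∧
      ∀ v, ∃ a ∈ W, ∃ b ∈ W, v = a + Complex.I • b := by
  obtain ⟨h, hs, hpos, hI, hG⟩ := exists_invariant_inner G
  let r : LinearMap.BilinForm ℝ V := LinearMap.mk₂ ℝ (fun x y => (q x y).re)
    (by simp) (by intro c x y; rw [← Complex.coe_smul]; simp) (by simp)
    (by intro c x y; rw [← Complex.coe_smul]; simp)
  have hr : ∀ x y, r x y = (q x y).re := fun _ _ => rfl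
  obtain ⟨S, hS, htop⟩ := exists_iSup_eigenspace_eq_top h r hs hpos
    (fun x y => by rw [hr, hr, qs])
  have hext : ∀ x y, (∀ z, h x z = h y z) → x = y := by
    intro x y H
    by_contra hne
    exact (hpos (x - y) (sub_ne_zero.2 hne)).ne' (by simp [H])
  -- $S$ is antilinear, since $r(ix,z)=r(x,iz)$ while $h$ is invariant under $i$. Multiplication by
  -- $i$ therefore exchanges the eigenvalues $\mu$ and $-\mu$.
  have SI : ∀ x, S (Complex.I • x) = -(Complex.I • S x) := by
    intro x
    refine hext _ _ fun z => ?_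
    have : h (Complex.I • S x) z = - h (S x) (Complex.I • z) := by
      rw [← hI (S x), smul_smul]; simp
    rw [hS, map_neg, LinearMap.neg_apply, this, hS, hr, hr]
    simp
  have Sg : ∀ g ∈ G, ∀ x, S ((g : Module.End ℂ V) x) = (g : Module.End ℂ V) (S x) := by
    intro g hg x
    refine hext _ _ fun z => ?_
    obtain ⟨w, rfl⟩ : ∃ w, (g : Module.End ℂ V) w = z :=
      ⟨(g⁻¹ : LinearMap.GeneralLinearGroup ℂ V) • z, smul_inv_smul g z⟩
    rw [hS, hr, hq g hg, hG g hg, hS, hr]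
  have horth : ∀ μ ν : ℝ, μ ≠ ν → ∀ x ∈ Module.End.eigenspace S μ,
      ∀ y ∈ Module.End.eigenspace S ν, h x y = 0 := by
    intro μ ν hne x hx y hy
    rw [Module.End.mem_eigenspace_iff] at hx hy
    have h1 : h (S x) y = μ * h x y := by rw [hx]; simp
    have h2 : h (S y) x = ν * h x y := by rw [hy, hs x y]; simp
    have h3 : h (S x) y = h (S y) x := by rw [hS, hS, hr, hr, qs]
    have : (μ - ν) * h x y = 0 := by linarith
    exact (mul_eq_zero.1 this).resolve_left (sub_ne_zero.2 hne)
  have hreig : ∀ μ : ℝ, ∀ x ∈ Module.End.eigenspace S μ, ∀ y, r x y = μ * h x y := by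
    intro μ x hx y
    rw [Module.End.mem_eigenspace_iff] at hx
    rw [← hS, hx]; simp
  let W : Submodule ℝ V := ⨆ μ : Set.Ioi (0 : ℝ), Module.End.eigenspace S μ
  have hmemW : ∀ μ : ℝ, 0 < μ → ∀ x ∈ Module.End.eigenspace S μ, x ∈ W := fun μ hμ x hx =>
    (le_iSup (fun μ : Set.Ioi (0 : ℝ) => Module.End.eigenspace S (μ : ℝ)) ⟨μ, hμ⟩) hx
  have hIeig : ∀ μ : ℝ, ∀ x ∈ Module.End.eigenspace S μ,
      Complex.I • x ∈ Module.End.eigenspace S (-μ) := by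
    intro μ x hx
    rw [Module.End.mem_eigenspace_iff] at hx ⊢
    rw [SI, hx, smul_comm, neg_smul]
  refine ⟨W, fun g hg x hx => ?_, fun x hx y hy => ?_, fun x hx hne => ?_, fun v => ?_⟩
  · induction hx using Submodule.iSup_induction' with
    | mem μ x hx =>
      refine hmemW μ μ.2 _ ?_
      rw [Module.End.mem_eigenspace_iff] at hx ⊢
      rw [Sg g hg, hx, ← Complex.coe_smul, map_smul, Complex.coe_smul]
    | zero => simp
    | add x y _ _ hx hy =>
      rw [map_add]
      exact W.add_mem hx hy
  -- $\operatorname{Re} q(ix,y)=-\operatorname{Im} q(x,y)$, and $ix$ lies in the negative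
  -- eigenspaces, which are orthogonal to $W$.
  · have key : r (Complex.I • x) y = 0 := by
      induction hx using Submodule.iSup_induction' with
      | mem μ x hx =>
        induction hy using Submodule.iSup_induction' with
        | mem ν y hy =>
          rw [hreig _ _ (hIeig _ _ hx), horth (-μ) ν _ _ (hIeig _ _ hx) _ hy, mul_zero]
          have h1 : (0 : ℝ) < μ := μ.2
          have h2 : (0 : ℝ) < ν := ν.2
          linarith
        | zero => simp
        | add y z _ _ hy hz => rw [map_add, hy, hz, add_zero]
      | zero => simp
      | add x z _ _ hx hz =>
        rw [smul_add, map_add, LinearMap.add_apply, hx, hz, add_zero]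
    rw [hr] at key
    simpa using key
  · obtain ⟨f, hf, rfl⟩ := (Submodule.mem_iSup_iff_exists_finsupp _ _).1 hx
    rw [← hr]
    have h1 : r (f.sum fun _ x => x) (f.sum fun _ x => x)
        = ∑ μ ∈ f.support, (μ : ℝ) * h (f μ) (f μ) := by
      simp only [Finsupp.sum, map_sum, LinearMap.sum_apply]
      refine Finset.sum_congr rfl fun μ hμ => ?_
      rw [Finset.sum_eq_single μ]
      · exact hreig _ _ (hf μ) _
      · intro ν _ hne
        rw [hreig _ _ (hf ν), horth _ _ _ _ (hf ν) _ (hf μ), mul_zero]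
        exact fun h => hne (Subtype.ext h)
      · exact fun h => absurd hμ h
    rw [h1]
    apply Finset.sum_pos
    · intro μ hμ
      exact mul_pos μ.2 (hpos _ (Finsupp.mem_support_iff.1 hμ))
    · by_contra H
      rw [Finset.not_nonempty_iff_eq_empty, Finsupp.support_eq_empty] at H
      simp [H] at hne
  · have hv : v ∈ ⨆ μ, Module.End.eigenspace S μ := htop ▸ Submodule.mem_top
    induction hv using Submodule.iSup_induction' with
    | mem μ x hx =>
      rcases lt_trichotomy μ 0 with hμ | hμ | hμ
      · refine ⟨0, W.zero_mem, -(Complex.I • x), W.neg_mem (hmemW (-μ) (by linarith) _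
          (hIeig _ _ hx)), ?_⟩
        rw [smul_neg, smul_smul]; simp
      · refine ⟨0, W.zero_mem, 0, W.zero_mem, ?_⟩
        -- The kernel of $S$ is the radical of $\operatorname{Re} q$; testing against $iy$ as well
        -- shows that it lies in the radical of $q$.
        have hx0 : ∀ y, r x y = 0 := fun y => by rw [hreig _ _ hx, hμ, zero_mul]
        have : x = 0 := by
          refine qnd.1 x fun y => Complex.ext ?_ ?_
          · simpa [hr] using hx0 y
          · have := hx0 (Complex.I • y)
            simpa [hr] using this
        simp [this]
      · exact ⟨x, hmemW μ hμ x hx, 0, W.zero_mem, by simp⟩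
    | zero => exact ⟨0, W.zero_mem, 0, W.zero_mem, by simp⟩
    | add x y _ _ hx hy =>
      obtain ⟨a, ha, b, hb, rfl⟩ := hx
      obtain ⟨c, hc, d, hd, rfl⟩ := hy
      exact ⟨a + c, W.add_mem ha hc, b + d, W.add_mem hb hd, by rw [smul_add]; abel⟩

/-- Over the complex numbers every reflection triple comes from a real one with a positive definite
form. -/
theorem Triple.IsReflectionTriple.isComplexCoxeter {V : Type} [AddCommGroup V] [Module ℂ V]
    {A : Triple ℂ V} (hA : A.IsReflectionTriple) : A.IsComplexCoxeter := by
  refine ⟨hA, ?_⟩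
  have := hA.finite_rank
  have := hA.finite_group
  have qs := hA.symm.eq
  obtain ⟨W, hG, hre, hpos, hsp⟩ :=
    exists_real_form_of_form A.group A.form qs hA.nondegenerate hA.invariant
  let φ : A.group →* Module.End ℝ W :=
    { toFun := fun g => (((g : LinearMap.GeneralLinearGroup ℂ V) : Module.End ℂ V).restrictScalars
        ℝ).restrict (hG g g.2)
      map_one' := by ext; rfl
      map_mul' := fun g k => by ext; rfl }
  let ψ : A.group →* LinearMap.GeneralLinearGroup ℝ W := φ.toHomUnits
  have hψ : ∀ (g : A.group) (w : W), (((ψ g : Module.End ℝ W) w : W) : V)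
      = ((g : LinearMap.GeneralLinearGroup ℂ V) : Module.End ℂ V) w := fun _ _ => rfl
  let r : LinearMap.BilinForm ℝ W := LinearMap.mk₂ ℝ (fun x y => (A.form x y).re)
    (by simp) (by intro c x y; rw [Submodule.coe_smul, ← Complex.coe_smul]; simp) (by simp)
    (by intro c x y; rw [Submodule.coe_smul, ← Complex.coe_smul]; simp)
  have hr : ∀ x y : W, A.form x y = (r x y : ℂ) := fun x y =>
    Complex.ext rfl (by rw [hre _ x.2 _ y.2, Complex.ofReal_im])
  have rpos : ∀ x, x ≠ 0 → 0 < r x x := fun x hx => hpos x x.2 (by simpa using hx)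
  -- $W\cap iW=0$: if $a=-ib$ then $q(a,a)=-q(b,b)$, against positivity on $W$.
  have hind : ∀ a ∈ W, ∀ b ∈ W, a + Complex.I • b = 0 → a = 0 ∧ b = 0 := by
    intro a ha b hb hab
    have h1 : a = -(Complex.I • b) := eq_neg_of_add_eq_zero_left hab
    have h2 : A.form a a = - A.form b b := by
      rw [h1]; simp [← mul_assoc]
    have h3 : b = 0 := by
      by_contra hne
      have := hpos b hb hne
      by_cases ha0 : a = 0
      · rw [ha0] at h2
        have := congrArg Complex.re h2
        simp at this
        linarith
      · have h4 := hpos a ha ha0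
        rw [h2, Complex.neg_re] at h4
        linarith
    exact ⟨by simpa [h3] using h1, h3⟩
  have hrefl : ∀ g : A.group,
      IsReflection ((g : LinearMap.GeneralLinearGroup ℂ V) : Module.End ℂ V) →
      IsReflection (ψ g : Module.End ℝ W) := by
    intro g hg
    obtain ⟨l, a, x₀, hx₀, hl⟩ := hg.exists_smul_sub
    obtain ⟨hsq, hne⟩ := orderOf_eq_prime_iff.1 hg.1
    have hsq' : ∀ x, ((g : LinearMap.GeneralLinearGroup ℂ V) : Module.End ℂ V)
        (((g : LinearMap.GeneralLinearGroup ℂ V) : Module.End ℂ V) x) = x := by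
      intro x
      simpa [sq] using LinearMap.congr_fun hsq x
    set s : Module.End ℂ V := ((g : LinearMap.GeneralLinearGroup ℂ V) : Module.End ℂ V) with hs
    obtain ⟨w₀, hw₀⟩ : ∃ w : W, s w ≠ w := by
      by_contra! H
      refine hne (LinearMap.ext fun v => ?_)
      obtain ⟨a, ha, b, hb, rfl⟩ := hsp v
      simpa using congrArg₂ (fun x y => x + Complex.I • y) (H ⟨a, ha⟩) (H ⟨b, hb⟩)
    -- A real root of the reflection. The form $l$ need not be real on $W$, so the hyperplane is
    -- taken to be the $r$-orthogonal of `a'`.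
    let a' : W := w₀ - (ψ g : Module.End ℝ W) w₀
    have ha' : (a' : V) = w₀ - s w₀ := rfl
    have ha'0 : a' ≠ 0 := fun h => hw₀ (by
      have h' : (a' : V) = 0 := by rw [h]; rfl
      rw [ha', sub_eq_zero] at h'
      exact h'.symm)
    have hl0 : l w₀ ≠ 0 := by
      intro h0
      have := hl w₀
      rw [h0, zero_smul, smul_eq_zero_iff_right hx₀, sub_eq_zero] at this
      exact hw₀ this.symm
    have hsa : s a' = -a' := by rw [ha', map_sub, hsq', neg_sub]
    refine ⟨orderOf_eq_prime_iff.2 ⟨?_, fun h => hw₀ ?_⟩, r a', fun h => ?_, fun w hw => ?_⟩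
    · ext w
      rw [sq]
      exact hsq' w
    · rw [hs, ← hψ, h]; rfl
    · have := rpos a' ha'0
      simp [h] at this
    -- Invariance gives $w-sw\perp a'$; but $w-sw$ is proportional to $a'$, and $q(a',a')\neq0$.
    · have h1 : A.form a' w = 0 := by rw [hr, hw, Complex.ofReal_zero]
      have h2 : A.form a' (s w) = 0 := by
        have := hA.invariant g g.2 a' w
        rw [← hs, hsa, h1, map_neg, LinearMap.neg_apply, neg_eq_zero] at this
        exact this
      have h3 : l w₀ • ((w : V) - s w) = l w • (a' : V) := by
        have : l x₀ • l w₀ • ((w : V) - s w) = l x₀ • l w • (a' : V) := by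
          rw [smul_comm, hl, smul_comm (l x₀) (l w), ha', hl, smul_comm]
        exact smul_right_injective V hx₀ this
      have h4 : A.form a' (l w • (a' : V)) = 0 := by
        rw [← h3, map_smul, map_sub, h1, h2]; simp
      have h5 : l w = 0 := by
        rw [map_smul, smul_eq_mul, hr] at h4
        exact (mul_eq_zero.1 h4).resolve_right (Complex.ofReal_ne_zero.2 (rpos a' ha'0).ne')
      rw [h5, zero_smul, smul_eq_zero_iff_right hl0, sub_eq_zero] at h3
      exact Subtype.ext h3.symm
  let B : Triple ℝ W := ⟨ψ.range, r⟩
  have hB : B.IsClassicalCoxeter := by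
    refine ⟨⟨inferInstance, inferInstance, ?_, closure_reflections_range hA.generated ψ hrefl,
      ?_, ⟨fun x y => ?_⟩, ?_⟩, rpos⟩
    · exact Set.finite_range ψ
    · rintro _ ⟨g, rfl⟩ x y
      exact congrArg Complex.re (hA.invariant g g.2 x y)
    · exact congrArg Complex.re (qs x y)
    · refine LinearMap.BilinForm.Nondegenerate.ofSeparatingLeft fun x hx => ?_
      by_contra hne
      exact (rpos x hne).ne' (hx x)
  let f : ℂ ⊗[ℝ] W →ₗ[ℂ] V := LinearMap.liftBaseChange ℂ W.subtype
  have hf : ∀ (c : ℂ) (w : W), f (c ⊗ₜ w) = c • (w : V) := fun c w => by simp [f]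
  have hdec : ∀ z : ℂ ⊗[ℝ] W, ∃ a b : W, z = 1 ⊗ₜ a + Complex.I ⊗ₜ b := by
    intro z
    induction z with
    | zero => exact ⟨0, 0, by simp⟩
    | add x y hx hy =>
      obtain ⟨a, b, rfl⟩ := hx
      obtain ⟨c, d, rfl⟩ := hy
      exact ⟨a + c, b + d, by simp only [TensorProduct.tmul_add]; abel⟩
    | tmul c w =>
      refine ⟨c.re • w, c.im • w, ?_⟩
      rw [TensorProduct.tmul_smul, TensorProduct.tmul_smul, TensorProduct.smul_tmul',
        TensorProduct.smul_tmul', ← TensorProduct.add_tmul]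
      congr 1
      simp
  have hbij : Function.Bijective f := by
    refine ⟨(injective_iff_map_eq_zero f).2 fun z hz => ?_, fun v => ?_⟩
    · obtain ⟨a, b, rfl⟩ := hdec z
      rw [map_add, hf, hf, one_smul] at hz
      obtain ⟨h1, h2⟩ := hind a a.2 b b.2 hz
      rw [ZeroMemClass.coe_eq_zero] at h1 h2
      simp [h1, h2]
    · obtain ⟨a, ha, b, hb, rfl⟩ := hsp v
      exact ⟨1 ⊗ₜ ⟨a, ha⟩ + Complex.I ⊗ₜ ⟨b, hb⟩, by simp [hf]⟩
  let e : ℂ ⊗[ℝ] W ≃ₗ[ℂ] V := LinearEquiv.ofBijective f hbij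
  refine ⟨W, inferInstance, inferInstance, B, hB, e, ?_, fun x y => ?_⟩
  · change (ψ.range.map _).map _ = _
    rw [MonoidHom.map_range, MonoidHom.map_range]
    conv_rhs => rw [← A.group.range_subtype]
    congr 1
    ext g v
    obtain ⟨z, rfl⟩ := hbij.2 v
    change e (Module.End.baseChangeHom ℝ ℂ W (ψ g) (e.symm (e z))) = _
    rw [e.symm_apply_apply]
    change f _ = ((g : LinearMap.GeneralLinearGroup ℂ V) : Module.End ℂ V) (f z)
    induction z with
    | zero => simp
    | add x y hx hy => simp only [map_add, hx, hy]
    | tmul c w => rw [baseChangeHom_tmul, hf, hf, hψ, map_smul]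
  · have : A.form.comp f f = B.form.baseChange ℂ := by
      ext x y
      simp [hf, hr, B]
    exact congrArg (fun C : LinearMap.BilinForm ℂ _ => C x y) this

end RealForm

/-! ### Adic limits and lifting of idempotents. -/

section AdicLimits

variable {R : Type*} [CommRing R] {ϖ : R}

theorem exists_adic_limit [IsPrecomplete (Ideal.span {ϖ}) R] (f : ℕ → R)
    (hf : ∀ n, ϖ ^ n ∣ f (n + 1) - f n) : ∃ L, ∀ n, ϖ ^ n ∣ f n - L := by
  have key : ∀ n (x y : R), x ≡ y [SMOD (Ideal.span {ϖ} ^ n • ⊤ : Submodule R R)] ↔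
      ϖ ^ n ∣ x - y := by
    intro n x y
    rw [SModEq.sub_mem, smul_eq_mul, Ideal.mul_top, Ideal.span_singleton_pow,
      Ideal.mem_span_singleton]
  have hmn : ∀ m k, ϖ ^ m ∣ f m - f (m + k) := by
    intro m k
    induction k with
    | zero => simp
    | succ k ih =>
      have h1 := ((pow_dvd_pow ϖ (Nat.le_add_right m k)).trans (hf (m + k)))
      have := dvd_sub ih h1
      rwa [sub_sub, add_sub_cancel, add_assoc] at this
  obtain ⟨L, hL⟩ := IsPrecomplete.prec' (I := Ideal.span {ϖ}) f (fun {m n} hle => by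
    obtain ⟨k, rfl⟩ := Nat.exists_eq_add_of_le hle
    exact (key _ _ _).2 (hmn m k))
  exact ⟨L, fun n => (key _ _ _).1 (hL n)⟩

theorem eq_zero_of_forall_pow_dvd [IsHausdorff (Ideal.span {ϖ}) R] {x : R}
    (h : ∀ n, ϖ ^ n ∣ x) : x = 0 := by
  refine IsHausdorff.haus' (I := Ideal.span {ϖ}) x fun n => ?_
  rw [SModEq.zero, smul_eq_mul, Ideal.mul_top, Ideal.span_singleton_pow,
    Ideal.mem_span_singleton]
  exact h n

variable {N : Type*} [Fintype N]

/-- Newton iteration: an approximate idempotent matrix over a complete ring can be corrected to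
an idempotent that commutes with everything the approximation commutes with. -/
theorem exists_idempotent_of_approx [DecidableEq N] [IsAdicComplete (Ideal.span {ϖ}) R]
    (E₀ C₀ : Matrix N N R) (h₀ : E₀ * E₀ - E₀ = ϖ • C₀) :
    ∃ E : Matrix N N R, E * E = E ∧ (∃ C, E₀ - E = ϖ • C) ∧
      ∀ B, B * E₀ = E₀ * B → B * E = E * B := by
  -- Newton's step $a\mapsto 3a^2-2a^3$ for the equation $a^2=a$.
  let e : ℕ → Matrix N N R := fun k =>
    Nat.rec E₀ (fun _ a => 3 • (a * a) - 2 • (a * a * a)) k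
  have e0 : e 0 = E₀ := rfl
  have es : ∀ k, e (k + 1) = 3 • (e k * e k) - 2 • (e k * e k * e k) := fun _ => rfl
  have hd : ∀ k, ∃ C : Matrix N N R, e k * e k - e k = ϖ ^ (k + 1) • C := by
    intro k
    induction k with
    | zero => exact ⟨C₀, by rw [e0, h₀, zero_add, pow_one]⟩
    | succ k ih =>
      obtain ⟨C, hC⟩ := ih
      -- The new defect is a multiple of the square of the old one; gaining one power of $\varpi$
      -- per step is enough here.
      have h1 : e (k + 1) * e (k + 1) - e (k + 1) =
          (e k * e k - e k) * (e k * e k - e k) * (4 • (e k * e k - e k) - 3) := by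
        rw [es]; noncomm_ring
      refine ⟨ϖ ^ k • (C * C * (4 • (e k * e k - e k) - 3)), ?_⟩
      rw [h1]
      nth_rewrite 1 [hC]
      nth_rewrite 1 [hC]
      rw [smul_mul_smul_comm, smul_mul_assoc, smul_smul]
      congr 1
      ring
  have hstep : ∀ k, ∃ C : Matrix N N R, e (k + 1) - e k = ϖ ^ (k + 1) • C := by
    intro k
    obtain ⟨C, hC⟩ := hd k
    refine ⟨-(C * (2 • e k - 1)), ?_⟩
    rw [smul_neg, ← smul_mul_assoc, ← hC, es]
    noncomm_ring
  have hlim : ∀ i j, ∃ L, ∀ n, ϖ ^ n ∣ e n i j - L := by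
    intro i j
    refine exists_adic_limit (fun n => e n i j) fun n => ?_
    obtain ⟨C, hC⟩ := hstep n
    have := congrFun (congrFun hC i) j
    rw [Matrix.sub_apply, Matrix.smul_apply, smul_eq_mul] at this
    rw [this]
    exact dvd_mul_of_dvd_left (pow_dvd_pow _ n.le_succ) _
  choose E hE using hlim
  have hE' : ∀ n, ∃ C : Matrix N N R, e n - Matrix.of E = ϖ ^ n • C := by
    intro n
    choose C hC using fun i j => hE i j n
    exact ⟨Matrix.of C, by ext i j; simp [hC]⟩
  have hzero : ∀ A : Matrix N N R, (∀ n, ∃ C : Matrix N N R, A = ϖ ^ n • C) → A = 0 := by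
    intro A hA
    ext i j
    refine eq_zero_of_forall_pow_dvd (ϖ := ϖ) fun n => ?_
    obtain ⟨C, hC⟩ := hA n
    exact ⟨C i j, by rw [hC]; simp⟩
  refine ⟨Matrix.of E, ?_, ?_, fun B hB => ?_⟩
  · rw [← sub_eq_zero]
    refine hzero _ fun n => ?_
    obtain ⟨C, hC⟩ := hE' n
    obtain ⟨D, hD⟩ := hd n
    refine ⟨ϖ • D - C * Matrix.of E - e n * C + C, ?_⟩
    rw [smul_add, smul_sub, smul_sub, smul_smul, ← pow_succ, ← hD, ← smul_mul_assoc,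
      ← mul_smul_comm, ← hC]
    noncomm_ring
  · obtain ⟨C, hC⟩ := hE' 1
    obtain ⟨D, hD⟩ := hstep 0
    refine ⟨C - D, ?_⟩
    rw [pow_one] at hC
    rw [zero_add, pow_one, e0] at hD
    rw [smul_sub, ← hC, ← hD]
    abel
  · have hcomm : ∀ n, B * e n = e n * B := by
      intro n
      induction n with
      | zero => exact hB
      | succ n ih =>
        have ih' : Commute B (e n) := ih
        rw [es]
        exact (((ih'.mul_right ih').smul_right 3).sub_right
          (((ih'.mul_right ih').mul_right ih').smul_right 2)).eq
    rw [← sub_eq_zero]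
    refine hzero _ fun n => ?_
    obtain ⟨C, hC⟩ := hE' n
    refine ⟨C * B - B * C, ?_⟩
    rw [smul_sub, ← smul_mul_assoc, ← mul_smul_comm, ← hC, sub_mul, mul_sub, hcomm]
    abel

end AdicLimits

/-! ### Finiteness of field extensions by means of derivations. -/

section Derivations

variable {k L : Type*} [Field k] [Field L] [Algebra k L]

/-- A finitely generated field extension without derivations is finite. -/
theorem finiteDimensional_adjoin_of_derivation {S : Set L} (hS : S.Finite)
    (h : ∀ D : Derivation k (IntermediateField.adjoin k S) (IntermediateField.adjoin k S),
      ∀ x : IntermediateField.adjoin k S, (x : L) ∈ S → D x = 0) :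
    FiniteDimensional k (IntermediateField.adjoin k S) := by
  let K := IntermediateField.adjoin k S
  have hD : ∀ D : Derivation k K K, ∀ x, D x = 0 := by
    rintro D ⟨x, hx⟩
    induction hx using IntermediateField.adjoin_induction with
    | mem x hx => exact h D _ hx
    | algebraMap r => exact D.map_algebraMap r
    | add x y hx hy ihx ihy =>
      have : D (⟨x, hx⟩ + ⟨y, hy⟩) = 0 := by rw [map_add, ihx, ihy, add_zero]
      exact this
    | inv x hx ihx =>
      have : D (⟨x, hx⟩⁻¹) = 0 := by rw [D.leibniz_inv, ihx, smul_zero]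
      exact this
    | mul x y hx hy ihx ihy =>
      have : D (⟨x, hx⟩ * ⟨y, hy⟩) = 0 := by rw [D.leibniz, ihx, ihy]; simp
      exact this
  have : Algebra.EssFiniteType k K := by
    rw [IntermediateField.essFiniteType_iff]
    exact ⟨hS.toFinset, by simp [K]⟩
  have : Algebra.FormallyUnramified k K := by
    -- Linear functionals on the Kähler differentials are derivations $K\to K$; as these vanish, so
    -- does the module of differentials.
    refine ⟨⟨fun x y => ?_⟩⟩
    rw [← sub_eq_zero, ← Module.forall_dual_apply_eq_zero_iff K]
    intro φ
    generalize x - y = w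
    have hmem : w ∈ Submodule.span K (Set.range (KaehlerDifferential.D k K)) := by
      rw [KaehlerDifferential.span_range_derivation]; trivial
    induction hmem using Submodule.span_induction with
    | mem z hz =>
      obtain ⟨a, rfl⟩ := hz
      exact hD (φ.compDer (KaehlerDifferential.D k K)) a
    | zero => simp
    | add a b _ _ ha hb => rw [map_add, ha, hb, add_zero]
    | smul c a _ ha => rw [map_smul, ha, smul_zero]
  exact Algebra.FormallyUnramified.finite_of_free k K

theorem map_derivation_mul {K N : Type*} [Field K] [Algebra k K] [Fintype N]
    (D : Derivation k K K) (A B : Matrix N N K) :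
    (A * B).map D = A.map D * B + A * B.map D := by
  ext i j
  simp only [Matrix.map_apply, Matrix.mul_apply, Matrix.add_apply, map_sum, D.leibniz,
    ← Finset.sum_add_distrib, smul_eq_mul]
  exact Finset.sum_congr rfl fun _ _ => by ring

/-- A derivation kills an idempotent matrix with which its derivative commutes. -/
theorem derivation_idempotent_eq_zero {K N : Type*} [Field K] [Algebra k K] [Fintype N]
    [DecidableEq N] (D : Derivation k K K) (E : Matrix N N K) (hE : E * E = E)
    (hc : E.map D * E = E * E.map D) : E.map D = 0 := by
  have h1 := map_derivation_mul D E E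
  rw [hE, hc] at h1
  -- Multiplying $D(E)=2E\,D(E)$ on the left by $E$.
  have h2 : E * E.map D = 0 := by
    have := congrArg (E * ·) h1
    simp only [mul_add, ← mul_assoc, hE] at this
    simpa using this
  rw [h1, h2, add_zero]

end Derivations

/-! ### Witt vectors and descent to a number field. -/

section Witt

/-- Turns a permutation symmetry into commutation with a matrix, the form in which it survives
Newton iteration. -/
theorem submatrix_perm_eq_iff {R N : Type*} [CommRing R] [Fintype N] [DecidableEq N]
    (σ : Equiv.Perm N) (A : Matrix N N R) :
    A.submatrix σ σ = A ↔ σ.toPEquiv.toMatrix * A = A * σ.toPEquiv.toMatrix := by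
  rw [PEquiv.toMatrix_toPEquiv_mul, PEquiv.mul_toMatrix_toPEquiv]
  constructor
  · intro h
    ext i j
    simpa using congrFun (congrFun h i) (σ.symm j)
  · intro h
    ext i j
    simpa using congrFun (congrFun h i) (σ j)

variable {F : Type*} [Field F]

theorem charZero_wittVector (p : ℕ) [Fact p.Prime] [CharP F p] : CharZero (WittVector p F) := by
  obtain ⟨c, hc⟩ := CharP.exists (WittVector p F)
  rcases CharP.char_is_prime_or_zero (WittVector p F) c with h | rfl
  · exfalso
    have h1 : ((c : ℕ) : F) = 0 := by
      rw [← map_natCast (WittVector.constantCoeff (p := p) (R := F)), CharP.cast_eq_zero, map_zero]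
    rw [CharP.cast_eq_zero_iff F p] at h1
    have h2 := (Nat.prime_dvd_prime_iff_eq Fact.out h).1 h1
    subst h2
    exact WittVector.p_nonzero p F (CharP.cast_eq_zero _ _)
  · exact CharP.charP_to_charZero _

theorem derivation_eq_zero_of_pow_eq_one {k K : Type*} [Field k] [Field K] [CharZero K]
    [Algebra k K] (D : Derivation k K K) {x : K} {n : ℕ} (hn : n ≠ 0) (hx : x ^ n = 1) :
    D x = 0 := by
  have h := D.leibniz_pow x n
  rw [hx, D.map_one_eq_zero] at h
  have hx0 : x ≠ 0 := by
    rintro rfl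
    simp [hn] at hx
  simpa [hn, hx0] using h.symm

/-- A subring of the ring of Witt vectors that is closed under exact division is a discrete valuation
ring. -/
theorem isDiscreteValuationRing_of_hom_wittVector (p : ℕ) [Fact p.Prime]
    [CharP F p] [PerfectRing F p] {T : Type*} [CommRing T] [IsDomain T]
    (φ : T →+* WittVector p F) (hφ : Function.Injective φ)
    (hdiv : ∀ (a b : T) (w : WittVector p F), b ≠ 0 → φ a = φ b * w → ∃ c, φ c = w) :
    IsDiscreteValuationRing T := by
  -- Exact division of $1$ by $x$. With this, $p$ is irreducible in $T$, and the factorization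
  -- $p^n\cdot$unit descends from the Witt vectors.
  have hunit : ∀ x, IsUnit (φ x) → IsUnit x := by
    intro x hx
    obtain ⟨u, hu⟩ := hx
    have hx0 : x ≠ 0 := by
      rintro rfl
      rw [map_zero] at hu
      exact u.ne_zero hu
    obtain ⟨c, hc⟩ := hdiv 1 x ↑u⁻¹ hx0 (by rw [← hu, map_one, Units.mul_inv])
    refine IsUnit.of_mul_eq_one c (hφ ?_)
    rw [map_mul, hc, ← hu, map_one, Units.mul_inv]
  have : IsLocalHom φ := ⟨hunit⟩
  refine IsDiscreteValuationRing.ofHasUnitMulPowIrreducibleFactorization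
    ⟨(p : T), ?_, fun {x} hx => ?_⟩
  · refine Irreducible.of_map (f := φ) ?_
    rw [map_natCast]
    exact WittVector.irreducible p
  · obtain ⟨n, b, hb⟩ := WittVector.exists_eq_pow_p_mul' (φ x) ((map_ne_zero_iff φ hφ).2 hx)
    have hp0 : (p : T) ^ n ≠ 0 := by
      refine pow_ne_zero _ fun h => WittVector.p_nonzero p F ?_
      rw [← map_natCast φ, h, map_zero]
    obtain ⟨c, hc⟩ := hdiv x ((p : T) ^ n) b hp0 (by rw [map_pow, map_natCast, hb])
    have hcu : IsUnit c := hunit c (by rw [hc]; exact b.isUnit)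
    refine ⟨n, hcu.unit, hφ ?_⟩
    rw [map_mul, map_pow, map_natCast, IsUnit.unit_spec, hc, hb]

/-- An idempotent matrix over a finite field lifts, together with its permutation symmetries, to a
discrete valuation ring in a number field with that residue field. -/
theorem exists_dvr_lift_idempotent [Finite F] {N : Type*} [Fintype N] [DecidableEq N] (e : Matrix N N F)
    (he : e * e = e) :
    ∃ (T : Subring ℂ) (_ : IsDiscreteValuationRing T) (f : T →+* F),
      NumberField (FractionRing T) ∧ Function.Surjective f ∧
      ∃ E : Matrix N N T, E * E = E ∧ E.map f = e ∧
        ∀ σ : Equiv.Perm N, e.submatrix σ σ = e → E.submatrix σ σ = E := by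
  obtain ⟨p, _⟩ := CharP.exists F
  have : Fact p.Prime := ⟨CharP.char_is_prime F p⟩
  let W := WittVector p F
  let L := FractionRing W
  have : CharZero W := charZero_wittVector p
  have hWL : Function.Injective (algebraMap W L) := IsFractionRing.injective W L
  have : CharZero L := charZero_of_injective_algebraMap hWL
  -- Teichmüller entries are zero or roots of unity, hence killed by derivations, and an entrywise
  -- lift keeps the permutation symmetries of `e`.
  let E₀ : Matrix N N W := e.map (WittVector.teichmuller p)
  have hE₀ : E₀.map WittVector.constantCoeff = e := by
    ext i j; simp [E₀]
  have happrox : ∃ C, E₀ * E₀ - E₀ = (p : W) • C := by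
    have h1 : ∀ i j, ∃ c, (E₀ * E₀ - E₀) i j = (p : W) * c := by
      intro i j
      have : (E₀ * E₀ - E₀) i j ∈ RingHom.ker (WittVector.constantCoeff (p := p) (R := F)) := by
        have h2 : (E₀ * E₀ - E₀).map WittVector.constantCoeff = 0 := by
          rw [Matrix.map_sub _ (map_sub _), Matrix.map_mul, hE₀, he, sub_self]
        exact congrFun (congrFun h2 i) j
      rw [WittVector.ker_constantCoeff, Ideal.mem_span_singleton] at this
      exact this
    choose C hC using h1
    exact ⟨Matrix.of C, by ext i j; simp [hC]⟩
  obtain ⟨C₀, hC₀⟩ := happrox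
  obtain ⟨E, hE, ⟨C, hC⟩, hcomm⟩ := exists_idempotent_of_approx (ϖ := (p : W)) E₀ C₀ hC₀
  have hEe : E.map WittVector.constantCoeff = e := by
    have h1 : (E₀ - E).map (WittVector.constantCoeff (p := p) (R := F)) = 0 := by
      rw [hC]
      ext i j : 2
      rw [Matrix.map_apply, Matrix.smul_apply, smul_eq_mul, map_mul, map_natCast,
        CharP.cast_eq_zero, zero_mul, Matrix.zero_apply]
    rw [Matrix.map_sub _ (map_sub _), hE₀, sub_eq_zero] at h1
    exact h1.symm
  -- All Teichmüller representatives are included, so that the residue map of the resulting ring is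
  -- onto $\mathbf F$.
  let S : Set L := Set.range (fun x : F => algebraMap W L (WittVector.teichmuller p x)) ∪
    Set.range (fun ij : N × N => algebraMap W L (E ij.1 ij.2))
  have hS : S.Finite := (Set.finite_range _).union (Set.finite_range _)
  let K := IntermediateField.adjoin ℚ S
  have hteich : ∀ x : F, algebraMap W L (WittVector.teichmuller p x) ∈ K := fun x =>
    IntermediateField.subset_adjoin _ _ (Or.inl ⟨x, rfl⟩)
  have hEmem : ∀ i j, algebraMap W L (E i j) ∈ K := fun i j =>
    IntermediateField.subset_adjoin _ _ (Or.inr ⟨(i, j), rfl⟩)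
  have hfin : FiniteDimensional ℚ K := by
    refine finiteDimensional_adjoin_of_derivation hS fun D x hx => ?_
    have hteichD : ∀ y : F, D ⟨_, hteich y⟩ = 0 := by
      intro y
      by_cases hy : y = 0
      · subst hy
        convert D.map_zero
        simp
      · have := Fintype.ofFinite F
        refine derivation_eq_zero_of_pow_eq_one D (n := Fintype.card F - 1) ?_ ?_
        · have := Fintype.one_lt_card (α := F)
          omega
        · ext
          rw [SubmonoidClass.coe_pow]
          simp only
          rw [← map_pow, ← map_pow, FiniteField.pow_card_sub_one_eq_one y hy]
          simp
    let EK : Matrix N N K := Matrix.of fun i j => ⟨_, hEmem i j⟩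
    let E₀K : Matrix N N K := Matrix.of fun i j => ⟨_, hteich (e i j)⟩
    have hval : Function.Injective (algebraMap K L) := (algebraMap K L).injective
    have hEKL : EK.map (algebraMap K L) = E.map (algebraMap W L) := rfl
    have hE₀KL : E₀K.map (algebraMap K L) = E₀.map (algebraMap W L) := rfl
    have hEK : EK * EK = EK := by
      apply Matrix.map_injective hval
      beta_reduce
      rw [Matrix.map_mul, hEKL, ← Matrix.map_mul, hE]
    have hEE₀ : EK * E₀K = E₀K * EK := by
      apply Matrix.map_injective hval
      beta_reduce
      rw [Matrix.map_mul, Matrix.map_mul, hEKL, hE₀KL, ← Matrix.map_mul, ← Matrix.map_mul,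
        hcomm E₀ rfl]
    -- Clearing denominators extends the bicommutant property of $E$ from $W$ to its fraction field,
    -- where $D(E)$ lives.
    have hcommL : ∀ B : Matrix N N L, B * E₀.map (algebraMap W L) = E₀.map (algebraMap W L) * B →
        B * E.map (algebraMap W L) = E.map (algebraMap W L) * B := by
      intro B hB
      obtain ⟨b, hb⟩ := IsLocalization.exist_integer_multiples_of_finite (nonZeroDivisors W)
        (fun ij : N × N => B ij.1 ij.2)
      choose c hc using hb
      let B' : Matrix N N W := Matrix.of fun i j => c (i, j)
      have hB' : B'.map (algebraMap W L) = (algebraMap W L b) • B := by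
        ext i j
        simp only [B', Matrix.map_apply, Matrix.of_apply, hc, Matrix.smul_apply]
        exact Algebra.smul_def _ _
      have h1 : B' * E₀ = E₀ * B' := by
        apply Matrix.map_injective hWL
        beta_reduce
        rw [Matrix.map_mul, Matrix.map_mul, hB', smul_mul_assoc, hB, mul_smul_comm]
      have h2 := congrArg (fun A => Matrix.map A (algebraMap W L)) (hcomm B' h1)
      simp only [Matrix.map_mul, hB', smul_mul_assoc, mul_smul_comm] at h2
      have hb0 : algebraMap W L b ≠ 0 := by
        rw [Ne, map_eq_zero_iff _ hWL]
        exact nonZeroDivisors.ne_zero b.2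
      exact smul_right_injective _ hb0 h2
    have hED : EK.map D = 0 := by
      refine derivation_idempotent_eq_zero D EK hEK ?_
      have h0 : E₀K.map D = 0 := by
        ext i j
        simp [E₀K, hteichD]
      -- Differentiating $EE_0=E_0E$ with $D(E_0)=0$.
      have h1 : EK.map D * E₀K = E₀K * EK.map D := by
        have := congrArg (fun A => Matrix.map A D) hEE₀
        simp only [map_derivation_mul, h0] at this
        simpa using this
      apply Matrix.map_injective hval
      beta_reduce
      rw [Matrix.map_mul, Matrix.map_mul, hEKL]
      apply hcommL
      rw [← hE₀KL, ← Matrix.map_mul, h1, Matrix.map_mul]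
    obtain ⟨x, hxK⟩ := x
    rcases hx with ⟨y, rfl⟩ | ⟨⟨i, j⟩, rfl⟩
    · exact hteichD y
    · exact congrFun (congrFun hED i) j
  have halg : Algebra.IsAlgebraic ℚ K := Algebra.IsAlgebraic.of_finite ℚ K
  let ι : K →+* ℂ := (IsAlgClosed.lift (R := ℚ) (S := K) (M := ℂ)).toRingHom
  -- $T_0=K\cap W$ inside $L$, and $T$ is its copy in $\mathbf C$; exact division in $W$ of elements
  -- of $K$ stays in $K$.
  let T₀ : Subring K := (algebraMap W L).range.comap (algebraMap K L)
  let T : Subring ℂ := T₀.map ι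
  let ε : T₀ ≃+* T := T₀.equivMapOfInjective ι ι.injective
  let r : W ≃+* (algebraMap W L).range := RingEquiv.ofBijective (algebraMap W L).rangeRestrict
    ⟨fun x y h => hWL (congrArg Subtype.val h), (algebraMap W L).rangeRestrict_surjective⟩
  let φ₀ : T₀ →+* W := r.symm.toRingHom.comp
    (((algebraMap K L).comp T₀.subtype).codRestrict (algebraMap W L).range fun x => x.2)
  have hφ₀ : ∀ x : T₀, algebraMap W L (φ₀ x) = ((x : K) : L) := by
    intro x
    exact congrArg Subtype.val (r.apply_symm_apply ⟨((x : K) : L), x.2⟩)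
  have hφ₀inj : Function.Injective φ₀ := by
    intro x y h
    have := congrArg (algebraMap W L) h
    rw [hφ₀, hφ₀] at this
    exact Subtype.ext (Subtype.ext this)
  have hmem : ∀ (w : W) (hw : algebraMap W L w ∈ K), ∃ t : T₀, (t : K) = ⟨_, hw⟩ ∧ φ₀ t = w := by
    intro w hw
    refine ⟨⟨⟨_, hw⟩, ⟨w, rfl⟩⟩, rfl, hWL ?_⟩
    rw [hφ₀]
  have hdvr₀ : IsDiscreteValuationRing T₀ := by
    refine isDiscreteValuationRing_of_hom_wittVector p φ₀ hφ₀inj fun a b w hb hw => ?_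
    have h1 := congrArg (algebraMap W L) hw
    rw [map_mul, hφ₀, hφ₀] at h1
    have hb0 : ((b : K) : L) ≠ 0 := by simpa using hb
    have hwK : algebraMap W L w ∈ K := by
      have : algebraMap W L w = ((a : K) : L) / ((b : K) : L) := by
        rw [h1, mul_div_cancel_left₀ _ hb0]
      rw [this]
      exact K.div_mem a.1.2 b.1.2
    obtain ⟨t, -, ht⟩ := hmem w hwK
    exact ⟨t, ht⟩
  have hdvr : IsDiscreteValuationRing T := IsDiscreteValuationRing.RingEquivClass.isDiscreteValuationRing ε
  let φ : T →+* W := φ₀.comp ε.symm.toRingHom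
  have hφinj : Function.Injective φ := hφ₀inj.comp ε.symm.injective
  let f : T →+* F := WittVector.constantCoeff.comp φ
  have hmemT : ∀ (w : W) (hw : algebraMap W L w ∈ K), ∃ t : T, φ t = w := by
    intro w hw
    obtain ⟨t, -, ht⟩ := hmem w hw
    exact ⟨ε t, by simp [φ, ht]⟩
  refine ⟨T, hdvr, f, ?_, fun x => ?_, ?_⟩
  · let j : T →+* K := T₀.subtype.comp ε.symm.toRingHom
    have hj : Function.Injective j := Subtype.val_injective.comp ε.symm.injective
    let j' : FractionRing T →+* K := IsFractionRing.lift hj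
    have : FiniteDimensional ℚ (FractionRing T) :=
      FiniteDimensional.of_injective (j'.toRatAlgHom.toLinearMap) j'.injective
    exact { to_charZero := inferInstance, to_finiteDimensional := this }
  · obtain ⟨t, ht⟩ := hmemT _ (hteich x)
    exact ⟨t, by simp [f, ht]⟩
  · choose ET hET using fun i j => hmemT _ (hEmem i j)
    have hmap : (Matrix.of ET).map φ = E := by
      exact Matrix.ext hET
    refine ⟨Matrix.of ET, ?_, ?_, fun σ hσ => ?_⟩
    · apply Matrix.map_injective hφinj
      beta_reduce
      rw [Matrix.map_mul, hmap, hE]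
    · rw [← hEe, ← hmap]
      rfl
    · apply Matrix.map_injective hφinj
      beta_reduce
      rw [← Matrix.submatrix_map, hmap]
      rw [submatrix_perm_eq_iff]
      apply hcomm
      rw [← submatrix_perm_eq_iff, Matrix.submatrix_map, hσ]

end Witt

/-! ### Lifting splittings, reflections and representations over a local ring. -/

section Lifting

variable {T F : Type*} [CommRing T] [Field F] (f : T →+* F)

theorem isUnit_of_isUnit_map [IsLocalHom f] {m : Type*} [Fintype m] [DecidableEq m]
    {A : Matrix m m T} (h : IsUnit (A.map f)) : IsUnit A := by
  rw [Matrix.isUnit_iff_isUnit_det] at h ⊢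
  rw [← RingHom.mapMatrix_apply, ← RingHom.map_det] at h
  exact isUnit_of_map_unit f _ h

theorem map_one_matrix {m : Type*} [DecidableEq m] : (1 : Matrix m m T).map f = 1 :=
  Matrix.map_one f (map_zero f) (map_one f)

/-- $1-E$ reduces to the identity, hence is invertible, and it annihilates $E$. -/
theorem eq_zero_of_idempotent_of_map [IsLocalHom f] {m : Type*} [Fintype m] [DecidableEq m]
    {E : Matrix m m T} (hE : E * E = E) (h : E.map f = 0) : E = 0 := by
  have hu : IsUnit (1 - E) := isUnit_of_isUnit_map f (by
    rw [Matrix.map_sub _ (map_sub f), h, sub_zero, map_one_matrix]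
    exact isUnit_one)
  refine hu.mul_left_cancel ?_
  rw [sub_mul, hE, one_mul, sub_self, mul_zero]

/-- A splitting of the reduction of an idempotent matrix over a local ring lifts. -/
theorem exists_lift_splitting [IsLocalHom f] (hf : Function.Surjective f) {N m : Type*}
    [Fintype N] [DecidableEq N] [Fintype m] [DecidableEq m] {E : Matrix N N T} (hE : E * E = E)
    (ι : Matrix N m F) (π : Matrix m N F) (h₁ : ι * π = E.map f) (h₂ : π * ι = 1) :
    ∃ (I : Matrix N m T) (P : Matrix m N T), I * P = E ∧ P * I = 1 ∧ I.map f = ι ∧ P.map f = π := by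
  let s := Function.surjInv hf
  have hs : ∀ x, f (s x) = x := Function.surjInv_eq hf
  have hI₀ : (ι.map s).map f = ι := by ext; simp [hs]
  have hP₀ : (π.map s).map f = π := by ext; simp [hs]
  -- Arbitrary lifts of $\iota$ and $\pi$, forced through the image of $E$. The product $P_1I$
  -- reduces to $1$, so its inverse $U$ corrects $P_1$ to a left inverse of $I$.
  let I := E * ι.map s
  let P₁ := π.map s * E
  have hI : I.map f = ι := by
    rw [Matrix.map_mul, hI₀, ← h₁, Matrix.mul_assoc, h₂, Matrix.mul_one]
  have hP₁ : P₁.map f = π := by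
    rw [Matrix.map_mul, hP₀, ← h₁, ← Matrix.mul_assoc, h₂, Matrix.one_mul]
  have hPI : (P₁ * I).map f = 1 := by rw [Matrix.map_mul, hI, hP₁, h₂]
  obtain ⟨u, hu⟩ := isUnit_of_isUnit_map f (A := P₁ * I) (by rw [hPI]; exact isUnit_one)
  let U : Matrix m m T := ↑u⁻¹
  have hU : U * (P₁ * I) = 1 := by rw [← hu]; exact u.inv_mul
  have hUf : U.map f = 1 := by
    have := congrArg (fun A => Matrix.map A f) hU
    simp only [map_one_matrix] at this
    rwa [Matrix.map_mul, hPI, Matrix.mul_one] at this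
  have hP : (U * P₁).map f = π := by rw [Matrix.map_mul, hUf, hP₁, Matrix.one_mul]
  have hPI1 : (U * P₁) * I = 1 := by rw [Matrix.mul_assoc, hU]
  refine ⟨I, U * P₁, ?_, hPI1, hI, hP⟩
  have hEI : E * I = I := by simp only [I, ← Matrix.mul_assoc, hE]
  have hPE : U * P₁ * E = U * P₁ := by simp only [P₁, Matrix.mul_assoc, hE]
  set P := U * P₁
  have h3 : E * (I * P) = I * P := by rw [← Matrix.mul_assoc, hEI]
  have h4 : I * P * E = I * P := by rw [Matrix.mul_assoc, hPE]
  have h5 : I * P * (I * P) = I * P := by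
    rw [Matrix.mul_assoc, ← Matrix.mul_assoc P, hPI1, Matrix.one_mul]
  -- $IP$ is an idempotent absorbed by $E$ on both sides, so $E-IP$ is an idempotent reducing to
  -- $0$.
  have h6 : E - I * P = 0 := by
    refine eq_zero_of_idempotent_of_map f ?_ ?_
    · rw [sub_mul, mul_sub, mul_sub, hE, h3, h4, h5, sub_self, sub_zero]
    · rw [Matrix.map_sub _ (map_sub f), Matrix.map_mul, hI, hP, h₁, sub_self]
  exact (sub_eq_zero.1 h6).symm

/-- An involution over a local ring that reduces to a reflection is a reflection. -/
theorem isReflection_of_reduction [IsLocalHom f] (hf : Function.Surjective f) {m : Type*}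
    [Fintype m] [DecidableEq m] (h2 : (2 : F) ≠ 0) {s : Matrix m m T} (hs : s * s = 1)
    (hr : IsReflection (Matrix.toLin' (s.map f))) : IsReflection (Matrix.toLin' s) := by
  obtain ⟨l, a, x₀, hx₀, hl⟩ := hr.exists_smul_sub
  obtain ⟨-, hne⟩ := orderOf_eq_prime_iff.1 hr.1
  have hne' : s.map f ≠ 1 := by
    intro h
    rw [h, Matrix.toLin'_one] at hne
    exact hne rfl
  have hu2 : IsUnit (2 : T) := isUnit_of_map_unit f _ (by
    rw [map_ofNat]; exact h2.isUnit)
  obtain ⟨u, hu⟩ := hu2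
  let h : T := ↑u⁻¹
  have hh : 2 * h = 1 := by rw [← hu]; exact u.mul_inv
  -- The projection onto the $(-1)$-eigenspace of $s$; `h` is $1/2$.
  let E : Matrix m m T := h • (1 - s)
  have hE : E * E = E := by
    have : (1 - s) * (1 - s) = (2 : T) • (1 - s) := by
      rw [sub_mul, mul_sub, mul_sub, hs, two_smul]
      simp
      abel
    rw [smul_mul_smul_comm, this, smul_smul, mul_assoc, mul_comm h 2, hh, mul_one]
  -- Rank-one factorization of the reduced projection, $x\mapsto \tfrac12\,l(x_0)^{-1}l(x)\,a$.
  let ι : Matrix m Unit F := Matrix.of fun i _ => f h * (l x₀)⁻¹ * a i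
  let π : Matrix Unit m F := Matrix.of fun _ j => l (Pi.single j 1)
  have hιπ : ι * π = E.map f := by
    ext i j
    have h1 := congrFun (hl (Pi.single j 1)) i
    simp only [Pi.smul_apply, Pi.sub_apply, smul_eq_mul, Matrix.toLin'_apply,
      Matrix.mulVec_single_one, Matrix.col_apply, Matrix.map_apply] at h1
    have h3 : (1 : Matrix m m F) i j = (Pi.single j 1 : m → F) i := by
      rw [Matrix.one_apply, Pi.single_apply]
    have h4 : f ((1 : Matrix m m T) i j) = (1 : Matrix m m F) i j := by
      rw [← map_one_matrix f]; rfl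
    simp only [Matrix.mul_apply, ι, π, Matrix.of_apply, Finset.univ_unique, Finset.sum_singleton,
      E, Matrix.map_apply, Matrix.smul_apply, smul_eq_mul, map_mul, Matrix.sub_apply, map_sub, h4,
      h3]
    field_simp
    rw [mul_assoc, mul_assoc, h1, mul_comm (a i)]
  have hπι : π * ι = 1 := by
    have hEf : E.map f * E.map f = E.map f := by rw [← Matrix.map_mul, hE]
    have hE0 : E.map f ≠ 0 := by
      intro h0
      apply hne'
      have hE2 : (2 : T) • E = 1 - s := by rw [smul_smul, hh, one_smul]
      have h5 : (1 - s).map f = 0 := by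
        rw [← hE2]
        ext i j
        have := congrFun (congrFun h0 i) j
        rw [Matrix.map_apply] at this
        simp [this]
      rw [Matrix.map_sub _ (map_sub f), map_one_matrix, sub_eq_zero] at h5
      exact h5.symm
    obtain ⟨i, j, hij⟩ : ∃ i j, (ι * π) i j ≠ 0 := by
      by_contra! H
      exact hE0 (by rw [← hιπ]; ext i j; exact H i j)
    rw [← hιπ] at hEf
    -- $\pi\iota$ is a scalar, and idempotence of the nonzero matrix $\iota\pi$ forces it to be $1$.
    have h6 : ι * (π * ι) * π = ι * π := by
      rw [← hEf]; simp only [Matrix.mul_assoc]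
    have h7 := congrFun (congrFun h6 i) j
    ext ⟨⟩ ⟨⟩
    simp only [Matrix.mul_apply, Finset.univ_unique, Finset.sum_singleton] at h7 hij
    rw [mul_right_comm] at h7
    simpa [Matrix.mul_apply] using (mul_eq_left₀ hij).1 h7
  obtain ⟨I, P, hIP, hPI, -, -⟩ := exists_lift_splitting f hf hE ι π hιπ hπι
  have hs1 : s = 1 - (2 : T) • (I * P) := by
    rw [hIP, smul_smul, hh, one_smul, sub_sub_cancel]
  refine ⟨orderOf_eq_prime_iff.2 ⟨?_, fun h1 => hne' ?_⟩,
    LinearMap.proj () ∘ₗ Matrix.toLin' P, fun h0 => ?_, fun x hx => ?_⟩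
  · rw [sq, Module.End.mul_eq_comp, ← Matrix.toLin'_mul, hs, Matrix.toLin'_one]; rfl
  · have : s = 1 := by
      apply Matrix.toLin'.injective
      rw [h1, Matrix.toLin'_one]; rfl
    rw [this, map_one_matrix]
  · have h3 := LinearMap.congr_fun h0 (I.mulVec 1)
    have : Nontrivial T := f.domain_nontrivial
    simp [Matrix.mulVec_mulVec, hPI] at h3
  · have hx' : P.mulVec x = 0 := by
      ext ⟨⟩
      simpa using hx
    rw [Matrix.toLin'_apply, hs1, Matrix.sub_mulVec, Matrix.smul_mulVec, ← Matrix.mulVec_mulVec,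
      hx']
    simp

end Lifting

/-- A representation of a finite group over a finite field of characteristic prime to the group
order lifts to a discrete valuation ring in a number field with that residue field. -/
theorem exists_lift_representation {F G : Type*} [Field F] [Finite F] [Group G] [Finite G]
    (hG : (Nat.card G : F) ≠ 0) {m : Type*} [Fintype m] [DecidableEq m]
    (ρ : G →* Matrix m m F) :
    ∃ (T : Subring ℂ) (_ : IsDiscreteValuationRing T) (f : T →+* F),
      NumberField (FractionRing T) ∧ Function.Surjective f ∧
      ∃ ρ' : G →* Matrix m m T, ∀ g, (ρ' g).map f = ρ g := by
  classical
  have := Fintype.ofFinite G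
  let c : F := (Nat.card G : F)⁻¹
  -- $\iota$ sends $v$ to the function $g\mapsto|G|^{-1}\rho(g^{-1})v$, and $\pi$ sends $\varphi$ to
  -- $\sum_g\rho(g)\varphi(g)$.
  let ι : Matrix (G × m) m F := Matrix.of fun x j => c * ρ x.1⁻¹ x.2 j
  let π : Matrix m (G × m) F := Matrix.of fun i y => ρ y.1 i y.2
  -- The $G$-coordinates enter only through $g^{-1}h$, so left translations are symmetries of
  -- $\iota\pi$.
  have hιπ : ∀ x y, (ι * π) x y = c * ρ (x.1⁻¹ * y.1) x.2 y.2 := by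
    intro x y
    simp only [ι, π, Matrix.mul_apply, Matrix.of_apply, map_mul, Finset.mul_sum, mul_assoc]
  have hπι : π * ι = 1 := by
    ext i j
    have h1 : ∀ g : G, ∑ k, ρ g i k * (c * ρ g⁻¹ k j) = c * (1 : Matrix m m F) i j := by
      intro g
      rw [← map_one ρ, ← mul_inv_cancel g, map_mul, Matrix.mul_apply, Finset.mul_sum]
      exact Finset.sum_congr rfl fun _ _ => by ring
    simp only [ι, π, Matrix.mul_apply, Matrix.of_apply, Fintype.sum_prod_type, h1,
      Finset.sum_const, Finset.card_univ, nsmul_eq_mul, ← Nat.card_eq_fintype_card]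
    rw [← mul_assoc, mul_inv_cancel₀ hG, one_mul]
  have he : ι * π * (ι * π) = ι * π := by
    rw [Matrix.mul_assoc, ← Matrix.mul_assoc π, hπι, Matrix.one_mul]
  obtain ⟨T, hT, f, hnf, hf, E, hE, hEf, hσ⟩ := exists_dvr_lift_idempotent (ι * π) he
  have : IsLocalHom f := .of_surjective f hf
  obtain ⟨I, P, hIP, hPI, hI, hP⟩ := exists_lift_splitting f hf hE ι π hEf.symm hπι
  let σ : G → Equiv.Perm (G × m) := fun g => (Equiv.mulLeft g).prodCongr (Equiv.refl m)
  -- The inverse makes $\Lambda$ multiplicative: `PEquiv.toMatrix` turns `trans`, which composes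
  -- from left to right, into the product.
  let Λ : G → Matrix (G × m) (G × m) T := fun g => (σ g⁻¹).toPEquiv.toMatrix
  have hΛ1 : Λ 1 = 1 := by
    have : σ 1⁻¹ = Equiv.refl _ := by ext x <;> simp [σ]
    simp only [Λ, this, Equiv.toPEquiv_refl, PEquiv.toMatrix_refl]
  have hΛmul : ∀ g h, Λ (g * h) = Λ g * Λ h := by
    intro g h
    simp only [Λ]
    rw [← PEquiv.toMatrix_trans, ← Equiv.toPEquiv_trans]
    congr 2
    ext x <;> simp [σ, mul_assoc]
  have hΛE : ∀ g, Λ g * E = E * Λ g := by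
    intro g
    refine (submatrix_perm_eq_iff _ _).1 (hσ _ ?_)
    ext x y
    simp [hιπ, σ]
  have hPE : P * E = P := by rw [← hIP, ← Matrix.mul_assoc, hPI, Matrix.one_mul]
  let ρ' : G →* Matrix m m T :=
    { toFun := fun g => P * Λ g * I
      map_one' := by rw [hΛ1, Matrix.mul_one, hPI]
      map_mul' := fun g h => by
        calc P * Λ (g * h) * I = P * E * (Λ g * Λ h) * I := by rw [hPE, hΛmul]
          _ = P * (E * Λ g) * Λ h * I := by simp only [Matrix.mul_assoc]
          _ = P * (Λ g * (I * P)) * Λ h * I := by rw [← hΛE, hIP]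
          _ = P * Λ g * I * (P * Λ h * I) := by simp only [Matrix.mul_assoc] }
  refine ⟨T, hT, f, hnf, hf, ρ', fun g => ?_⟩
  have h1 : (Λ g * I).map f = ι * ρ g := by
    simp only [Λ]
    rw [PEquiv.toMatrix_toPEquiv_mul, ← Matrix.submatrix_map, hI]
    ext x j
    simp [ι, σ, Matrix.mul_apply, mul_assoc, ← Finset.mul_sum]
  change (P * Λ g * I).map f = ρ g
  rw [Matrix.mul_assoc, Matrix.map_mul, h1, hP, ← Matrix.mul_assoc, hπι, Matrix.one_mul]

theorem IsReflection.conj {R M N : Type*} [CommRing R] [AddCommGroup M] [Module R M]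
    [AddCommGroup N] [Module R N] (e : M ≃ₗ[R] N) {s : Module.End R M} (hs : IsReflection s) :
    IsReflection (e.conjAlgEquiv R s) := by
  refine ⟨?_, ?_⟩
  · rw [← hs.1]
    exact orderOf_injective (e.conjAlgEquiv R : Module.End R M →* Module.End R N)
      (e.conjAlgEquiv R).injective s
  · obtain ⟨l, hl, h⟩ := hs.2
    refine ⟨l ∘ₗ e.symm.toLinearMap, fun h0 => hl ?_, fun x hx => ?_⟩
    · ext x
      simpa using LinearMap.congr_fun h0 (e x)
    · change e (s (e.symm x)) = x
      rw [show s (e.symm x) = e.symm x from h _ hx, e.apply_symm_apply]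

/-! ### The lifted form and the lifted triple in matrix terms. -/

section Matrices

variable {T F V : Type*} [CommRing T] [Field F] [AddCommGroup V] [Module F V] {n : ℕ}
  (f : T →+* F) {G : Type*} [Group G]

/-- An invariant form for a finite group of matrices over a finite field lifts along with the
group. -/
theorem exists_lift_form [Finite G] [IsLocalHom f] (hf : Function.Surjective f)
    (hG : (Nat.card G : F) ≠ 0) (ρ : G →* Matrix (Fin n) (Fin n) T)
    (Q : Matrix (Fin n) (Fin n) F) (hQ : Q.transpose = Q)
    (hinv : ∀ g, ((ρ g).map f).transpose * Q * (ρ g).map f = Q) :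
    ∃ Q' : Matrix (Fin n) (Fin n) T, Q'.map f = Q ∧ Q'.transpose = Q' ∧
      ∀ g, (ρ g).transpose * Q' * ρ g = Q' := by
  have := Fintype.ofFinite G
  let s := Function.surjInv hf
  have hs : ∀ x, f (s x) = x := Function.surjInv_eq hf
  obtain ⟨u, hu⟩ : IsUnit (Nat.card G : T) := isUnit_of_map_unit f _ (by
    rw [map_natCast]; exact hG.isUnit)
  have hQ₀ : (Q.map s).map f = Q := by ext; simp [hs]
  have hQ₀t : (Q.map s).transpose = Q.map s := by rw [← Matrix.transpose_map, hQ]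
  -- The average over $G$ of an entrywise lift of $Q$; its reduction is still $Q$ because $Q$ is
  -- invariant.
  refine ⟨(↑u⁻¹ : T) • ∑ g, (ρ g).transpose * Q.map s * ρ g, ?_, ?_, fun h => ?_⟩
  · have h1 : (∑ g, (ρ g).transpose * Q.map s * ρ g).map f = (Nat.card G : F) • Q := by
      rw [← RingHom.mapMatrix_apply, map_sum]
      simp only [RingHom.mapMatrix_apply, Matrix.map_mul, Matrix.transpose_map, hQ₀, hinv]
      rw [Finset.sum_const, Finset.card_univ, Nat.card_eq_fintype_card, Nat.cast_smul_eq_nsmul]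
    have h2 : f ↑u⁻¹ * (Nat.card G : F) = 1 := by
      rw [← map_natCast f, ← map_mul, ← hu, Units.inv_mul, map_one]
    rw [Matrix.map_smul' _ _ _ (map_mul f), h1, smul_smul, h2, one_smul]
  · rw [Matrix.transpose_smul, Matrix.transpose_sum]
    simp only [Matrix.transpose_mul, Matrix.transpose_transpose, hQ₀t, Matrix.mul_assoc]
  · rw [Matrix.mul_smul, Matrix.smul_mul, Matrix.mul_sum, Matrix.sum_mul]
    congr 1
    rw [← Equiv.sum_comp (Equiv.mulRight h) fun g => (ρ g).transpose * Q.map s * ρ g]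
    refine Finset.sum_congr rfl fun g _ => ?_
    simp only [Equiv.coe_mulRight, map_mul, Matrix.transpose_mul, Matrix.mul_assoc]

/-- The triple given by a matrix representation and a matrix of a bilinear form. -/
def matrixTriple (ρ : G →* Matrix (Fin n) (Fin n) T) (Q : Matrix (Fin n) (Fin n) T) :
    Triple T (Fin n → T) where
  group := ((Matrix.toLinAlgEquiv' : _ ≃ₐ[T] Module.End T (Fin n → T)) :
    Matrix (Fin n) (Fin n) T →* Module.End T (Fin n → T)).comp ρ |>.toHomUnits.range
  form := Matrix.toBilin' Q

theorem matrixTriple_isIsomorphic [Algebra T F] (A : Triple F V) (b : Module.Basis (Fin n) F V)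
    (ρ : A.group →* Matrix (Fin n) (Fin n) T) (Q : Matrix (Fin n) (Fin n) T)
    (hρ : ∀ g : A.group, (ρ g).map (algebraMap T F) =
      LinearMap.toMatrix b b ((g : LinearMap.GeneralLinearGroup F V) : Module.End F V))
    (hQ : Q.map (algebraMap T F) = LinearMap.BilinForm.toMatrix b A.form) :
    ((matrixTriple ρ Q).baseChange F).IsIsomorphic A := by
  let b' := (Pi.basisFun T (Fin n)).baseChange F
  let e : F ⊗[T] (Fin n → T) ≃ₗ[F] V := b'.equiv b (Equiv.refl _)
  have hb' : ∀ i, b' i = 1 ⊗ₜ Pi.single i 1 := fun i => by simp [b']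
  have he : ∀ i, e (b' i) = b i := fun i => by simp [e]
  have he' : ∀ v : Fin n → T, e (1 ⊗ₜ v) = ∑ i, algebraMap T F (v i) • b i := by
    intro v
    conv_lhs => rw [pi_eq_sum_univ' v]
    rw [TensorProduct.tmul_sum, map_sum]
    refine Finset.sum_congr rfl fun i _ => ?_
    rw [TensorProduct.tmul_smul, ← algebraMap_smul F (v i), map_smul, ← hb', he]
  refine ⟨e, ?_, fun x y => ?_⟩
  · change ((MonoidHom.range _).map _).map _ = _
    rw [MonoidHom.map_range, MonoidHom.map_range]
    conv_rhs => rw [← A.group.range_subtype]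
    congr 1
    ext g v
    obtain ⟨z, rfl⟩ := e.surjective v
    change e (Module.End.baseChangeHom T F _ (Matrix.toLin' (ρ g)) (e.symm (e z))) =
      ((g : LinearMap.GeneralLinearGroup F V) : Module.End F V) (e z)
    rw [e.symm_apply_apply]
    have key : e.toLinearMap ∘ₗ Module.End.baseChangeHom T F _ (Matrix.toLin' (ρ g)) =
        ((g : LinearMap.GeneralLinearGroup F V) : Module.End F V) ∘ₗ e.toLinearMap := by
      refine b'.ext fun j => ?_
      change e (Module.End.baseChangeHom T F _ (Matrix.toLin' (ρ g)) (b' j)) =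
        ((g : LinearMap.GeneralLinearGroup F V) : Module.End F V) (e (b' j))
      rw [he, hb', baseChangeHom_tmul, he',
        ← b.sum_repr (((g : LinearMap.GeneralLinearGroup F V) : Module.End F V) (b j))]
      refine Finset.sum_congr rfl fun i _ => ?_
      have := congrFun (congrFun (hρ g) i) j
      rw [LinearMap.toMatrix_apply, Matrix.map_apply] at this
      rw [← this]
      simp
    exact LinearMap.congr_fun key z
  · have key : A.form.comp e.toLinearMap e.toLinearMap =
        ((matrixTriple ρ Q).baseChange F).form := by
      refine LinearMap.BilinForm.ext_basis b' fun i j => ?_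
      have := congrFun (congrFun hQ i) j
      rw [LinearMap.BilinForm.toMatrix_apply, Matrix.map_apply] at this
      change A.form (e (b' i)) (e (b' j)) = LinearMap.BilinForm.baseChange F _ (b' i) (b' j)
      rw [he, he, ← this, hb', hb', LinearMap.BilinForm.baseChange_tmul]
      simp [matrixTriple, Algebra.smul_def]
    exact LinearMap.congr_fun₂ key x y

/-- A reflection $g$ satisfies $g^2=1$ already in the abstract group, so $\rho(g)$ is an involution
and `isReflection_of_reduction` applies. Nondegeneracy holds because $\det Q$ has nonzero reduction.
-/
theorem matrixTriple_isReflectionTriple [IsDomain T] [IsLocalHom f] (hf : Function.Surjective f)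
    (h2 : (2 : F) ≠ 0) {A : Triple F V} (hA : A.IsReflectionTriple)
    (b : Module.Basis (Fin n) F V)
    (ρ : A.group →* Matrix (Fin n) (Fin n) T) (Q : Matrix (Fin n) (Fin n) T)
    (hρ : ∀ g : A.group, (ρ g).map f =
      LinearMap.toMatrix b b ((g : LinearMap.GeneralLinearGroup F V) : Module.End F V))
    (hQ : Q.map f = LinearMap.BilinForm.toMatrix b A.form)
    (hQt : Q.transpose = Q) (hinv : ∀ g, (ρ g).transpose * Q * ρ g = Q) :
    (matrixTriple ρ Q).IsReflectionTriple := by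
  have := hA.finite_group
  refine ⟨inferInstance, inferInstance, Set.finite_range _,
    closure_reflections_range hA.generated _ fun g hg => ?_, ?_, ⟨fun x y => ?_⟩, ?_⟩
  · refine isReflection_of_reduction f hf h2 (s := ρ g) ?_ ?_
    · have hsq := (orderOf_eq_prime_iff.1 hg.1).1
      have : g ^ 2 = 1 := Subtype.ext (Units.ext hsq)
      rw [← map_mul, ← sq, this, map_one]
    · convert hg.conj b.equivFun
      refine LinearMap.ext fun x => ?_
      rw [hρ, Matrix.toLin'_apply]
      obtain ⟨v, rfl⟩ := b.equivFun.surjective x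
      rw [LinearEquiv.conjAlgEquiv_apply]
      simp only [LinearMap.comp_apply, LinearEquiv.coe_coe, LinearEquiv.symm_apply_apply]
      exact LinearMap.toMatrix_mulVec_repr b b _ v
  · rintro _ ⟨g, rfl⟩ x y
    have := Matrix.toBilin'_comp Q (ρ g) (ρ g)
    rw [hinv] at this
    exact LinearMap.congr_fun₂ this x y
  · change Matrix.toBilin' Q x y = Matrix.toBilin' Q y x
    rw [Matrix.toBilin'_apply', Matrix.toBilin'_apply', Matrix.dotProduct_mulVec,
      ← Matrix.mulVec_transpose, hQt, dotProduct_comm]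
  · refine LinearMap.BilinForm.nondegenerate_toBilin'_of_det_ne_zero' Q fun h0 => ?_
    have hd := (LinearMap.BilinForm.nondegenerate_iff_det_ne_zero b).1 hA.nondegenerate
    rw [← hQ, ← RingHom.mapMatrix_apply, ← RingHom.map_det, h0, map_zero] at hd
    exact hd rfl

end Matrices

end CoxeterArr

end

theorem proposition1p6 {F : Type*} [Field F] [Finite F] (p : ℕ) [CharP F p] (hp2 : p ≠ 2)
    {V : Type*} [AddCommGroup V] [Module F V] (A : CoxeterArr.Triple F V)
    (hA : A.IsCoxeterOverField) (hp : ¬ p ∣ Nat.card A.group) :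
    A.IsLiftable := by
  have hA' : A.IsReflectionTriple := hA
  have := hA'.finite_rank
  have := hA'.finite_group
  have hG : (Nat.card A.group : F) ≠ 0 := by rwa [Ne, CharP.cast_eq_zero_iff F p]
  have h2 : (2 : F) ≠ 0 := Ring.two_ne_zero (by rwa [ringChar.eq F p])
  let b := Module.finBasis F V
  let ρ : A.group →* Matrix (Fin (Module.finrank F V)) (Fin (Module.finrank F V)) F :=
    ((LinearMap.toMatrixAlgEquiv b : Module.End F V →* _).comp
      (Units.coeHom (Module.End F V))).comp A.group.subtype
  obtain ⟨T, hT, f, hnf, hf, ρ', hρ'⟩ := CoxeterArr.exists_lift_representation hG ρ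
  have : IsLocalHom f := .of_surjective f hf
  let Q := LinearMap.BilinForm.toMatrix b A.form
  have hQ : Q.transpose = Q := by
    ext i j
    simp only [Q, Matrix.transpose_apply, LinearMap.BilinForm.toMatrix_apply]
    exact hA'.symm.eq _ _
  obtain ⟨Q', hQ', hQ't, hQ'inv⟩ := CoxeterArr.exists_lift_form f hf hG ρ' Q hQ (fun g => by
    rw [hρ']
    change (LinearMap.toMatrix b b _).transpose * _ * LinearMap.toMatrix b b _ = _
    rw [← LinearMap.BilinForm.toMatrix_comp]
    congr 1
    refine LinearMap.ext fun x => LinearMap.ext fun y => ?_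
    exact hA'.invariant g g.2 x y)
  let _ : Algebra T F := f.toAlgebra
  have hB := CoxeterArr.matrixTriple_isReflectionTriple f hf h2 hA' b ρ' Q' hρ' hQ' hQ't hQ'inv
  exact ⟨T, hT, inferInstance, _, inferInstance, inferInstance, CoxeterArr.matrixTriple ρ' Q', hnf,
    hf, ⟨hB, (hB.baseChange Subtype.val_injective).isComplexCoxeter⟩,
    CoxeterArr.matrixTriple_isIsomorphic A b ρ' Q' hρ' hQ'⟩
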